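/- **Setting.** Gödel's System $T$ is the simply typed $\lambda$-calculus over the types generated from $\mathbb N$ and $\mathsf{Bool}$ by $\times$ and $\to$, with pairs and projections, $0$, successor, $\mathsf{True}$, $\mathsf{False}$, and a conditional and a primitive recursor in every type. For terms $t,u$ of the same type, $t=u$ means that the equation is provable in the usual equational theory of $T$ (the congruence generated by $\beta$, the projection rules, and the rules for the recursor and the conditional). Natural numbers are identified with numerals. Fix a bijective coding $|\cdot| : \mathbb N^3\cup\{\varnothing\}\to\mathbb N$ that is primitive recursive together with its inverse. For $k\in\mathbb N$, a *$k$-ary typed update procedure* is a closed term $U:(\mathbb N\to\mathbb N)^k\to\mathbb N$ (that is, $(\mathbb N\to\mathbb N)\to\cdots\to(\mathbb N\to\mathbb N)\to\mathbb N$, with $k$ arguments) of $T$ such that 1. for all closed terms $f_1,\dots,f_k:\mathbb N\to\mathbb N$ of $T$, if $U f_1\dots f_k=|(i,n,m)|$ then $1\le i\le k$; 2. for all closed terms $f_1,\dots,f_k,g_1,\dots,g_k:\mathbb N\to\mathbb N$ of $T$ and all $1\le i\le k$: if $f_j=g_j$ for all $j<i$, and $U f_1\dots f_k=|(i,n,m)|$,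 $g_i(n)=m$ and $U g_1\dots g_k=|(i,h,l)|$, then $h\ne n$. **Theorem (Zero theorem for typed update procedures).** (a) *(Unary case, with parameters.)* Let $k\in\mathbb N$ and let $U:(\mathbb N\to\mathbb N)^{k+1}\to\mathbb N$ be a closed term of $T$ such that, for all closed terms $f_1,\dots,f_k:\mathbb N\to\mathbb N$ of $T$, $U f_1\dots f_k$ is a unary typed update procedure. Then there is a closed term $\varepsilon:(\mathbb N\to\mathbb N)^k\to(\mathbb N\to\mathbb N)$ of $T$ such that $U f_1\dots f_k(\varepsilon f_1\dots f_k)=|\varnothing|$ for all closed terms $f_1,\dots,f_k:\mathbb N\to\mathbb N$ of $T$. (b) *($k$-ary case.)* Let $k\in\mathbb N$ and let $U:(\mathbb N\to\mathbb N)^k\to\mathbb N$ be a $k$-ary typed update procedure. Then there are closed terms $\varepsilon_1,\dots,\varepsilon_k:\mathbb N\to\mathbb N$ of $T$ such that $U\varepsilon_1\dots\varepsilon_k=|\varnothing|$. In both cases the terms can be constructed effectively: there are total computable functions that compute a (Gödel number of a) term $\varepsilon$ as in (a), respectively terms $\varepsilon_1,\dots,\varepsilon_k$ as in (b), from $k$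 and (a Gödel number of) $U$. -/

import Mathlib

namespace SystemT

/-- Types of Gödel's System T. -/
inductive Ty : Type
  | nat : Ty
  | bool : Ty
  | prod : Ty → Ty → Ty
  | arrow : Ty → Ty → Ty

/-- `Var Γ A`: variables of type `A` in the context `Γ` (typed de Bruijn indices). -/
inductive Var : List Ty → Ty → Type
  | zero {Γ : List Ty} {A : Ty} : Var (A :: Γ) A
  | succ {Γ : List Ty} {A B : Ty} : Var Γ A → Var (B :: Γ) A

/-- `Tm Γ A`: terms of System T of type `A` whose free variables are declared in `Γ`
(up to renaming of bound variables). Closed terms of type `A` are the elements of `Tm [] A`. -/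
inductive Tm : List Ty → Ty → Type
  | var {Γ : List Ty} {A : Ty} : Var Γ A → Tm Γ A
  | zero {Γ : List Ty} : Tm Γ Ty.nat
  | tt {Γ : List Ty} : Tm Γ Ty.bool
  | ff {Γ : List Ty} : Tm Γ Ty.bool
  /-- the conditional constant of type `Bool → A → A → A` -/
  | cond {Γ : List Ty} (A : Ty) : Tm Γ (Ty.arrow Ty.bool (Ty.arrow A (Ty.arrow A A)))
  /-- the recursion constant of type `A → (N → (A → A)) → N → A` -/
  | recn {Γ : List Ty} (A : Ty) :
      Tm Γ (Ty.arrow A (Ty.arrow (Ty.arrow Ty.nat (Ty.arrow A A)) (Ty.arrow Ty.nat A)))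
  | suc {Γ : List Ty} : Tm Γ Ty.nat → Tm Γ Ty.nat
  | app {Γ : List Ty} {A B : Ty} : Tm Γ (Ty.arrow A B) → Tm Γ A → Tm Γ B
  | fst {Γ : List Ty} {A B : Ty} : Tm Γ (Ty.prod A B) → Tm Γ A
  | snd {Γ : List Ty} {A B : Ty} : Tm Γ (Ty.prod A B) → Tm Γ B
  | pair {Γ : List Ty} {A B : Ty} : Tm Γ A → Tm Γ B → Tm Γ (Ty.prod A B)
  | lam {Γ : List Ty} {A B : Ty} : Tm (A :: Γ) B → Tm Γ (Ty.arrow A B)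

/-- Renamings of variables. -/
def Ren (Γ Δ : List Ty) : Type := ∀ A : Ty, Var Γ A → Var Δ A

/-- Simultaneous substitutions. -/
def Sub (Γ Δ : List Ty) : Type := ∀ A : Ty, Var Γ A → Tm Δ A

/-- A renaming under a binder. -/
def Ren.lift {Γ Δ : List Ty} (ρ : Ren Γ Δ) (B : Ty) : Ren (B :: Γ) (B :: Δ)
  | _, Var.zero => Var.zero
  | _, Var.succ x => Var.succ (ρ _ x)

def Tm.rename : {Γ : List Ty} → {A : Ty} → Tm Γ A → {Δ : List Ty} → Ren Γ Δ → Tm Δ A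
  | _, _, Tm.var x, _, ρ => Tm.var (ρ _ x)
  | _, _, Tm.zero, _, _ => Tm.zero
  | _, _, Tm.tt, _, _ => Tm.tt
  | _, _, Tm.ff, _, _ => Tm.ff
  | _, _, Tm.cond A, _, _ => Tm.cond A
  | _, _, Tm.recn A, _, _ => Tm.recn A
  | _, _, Tm.suc t, _, ρ => Tm.suc (t.rename ρ)
  | _, _, Tm.app t u, _, ρ => Tm.app (t.rename ρ) (u.rename ρ)
  | _, _, Tm.fst t, _, ρ => Tm.fst (t.rename ρ)
  | _, _, Tm.snd t, _, ρ => Tm.snd (t.rename ρ)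
  | _, _, Tm.pair t u, _, ρ => Tm.pair (t.rename ρ) (u.rename ρ)
  | _, _, Tm.lam (A := A) t, _, ρ => Tm.lam (t.rename (ρ.lift A))

/-- A substitution under a binder. -/
def Sub.lift {Γ Δ : List Ty} (σ : Sub Γ Δ) (B : Ty) : Sub (B :: Γ) (B :: Δ)
  | _, Var.zero => Tm.var Var.zero
  | _, Var.succ x => (σ _ x).rename (fun _ y => Var.succ y)

/-- Capture-avoiding simultaneous substitution. -/
def Tm.subst : {Γ : List Ty} → {A : Ty} → Tm Γ A → {Δ : List Ty} → Sub Γ Δ → Tm Δ A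
  | _, _, Tm.var x, _, σ => σ _ x
  | _, _, Tm.zero, _, _ => Tm.zero
  | _, _, Tm.tt, _, _ => Tm.tt
  | _, _, Tm.ff, _, _ => Tm.ff
  | _, _, Tm.cond A, _, _ => Tm.cond A
  | _, _, Tm.recn A, _, _ => Tm.recn A
  | _, _, Tm.suc t, _, σ => Tm.suc (t.subst σ)
  | _, _, Tm.app t u, _, σ => Tm.app (t.subst σ) (u.subst σ)
  | _, _, Tm.fst t, _, σ => Tm.fst (t.subst σ)
  | _, _, Tm.snd t, _, σ => Tm.snd (t.subst σ)
  | _, _, Tm.pair t u, _, σ => Tm.pair (t.subst σ) (u.subst σ)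
  | _, _, Tm.lam (A := A) t, _, σ => Tm.lam (t.subst (σ.lift A))

/-- The substitution that replaces the last declared variable by `u` and fixes the others. -/
def Sub.single {Γ : List Ty} {B : Ty} (u : Tm Γ B) : Sub (B :: Γ) Γ
  | _, Var.zero => u
  | _, Var.succ x => Tm.var x

/-- `t.inst u` is `t[u/x]`, where `x` is the last variable declared in the context of `t`. -/
def Tm.inst {Γ : List Ty} {A B : Ty} (t : Tm (B :: Γ) A) (u : Tm Γ B) : Tm Γ A :=
  t.subst (Sub.single u)

/-- The equational theory of System T: provable equality `t = u` of terms. -/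
inductive Conv : {Γ : List Ty} → {A : Ty} → Tm Γ A → Tm Γ A → Prop
  | refl {Γ : List Ty} {A : Ty} (t : Tm Γ A) : Conv t t
  | symm {Γ : List Ty} {A : Ty} {t u : Tm Γ A} : Conv t u → Conv u t
  | trans {Γ : List Ty} {A : Ty} {t u v : Tm Γ A} : Conv t u → Conv u v → Conv t v
  | suc {Γ : List Ty} {t u : Tm Γ Ty.nat} : Conv t u → Conv t.suc u.suc
  | app {Γ : List Ty} {A B : Ty} {t t' : Tm Γ (Ty.arrow A B)} {u u' : Tm Γ A} :
      Conv t t' → Conv u u' → Conv (t.app u) (t'.app u')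
  | pair {Γ : List Ty} {A B : Ty} {t t' : Tm Γ A} {u u' : Tm Γ B} :
      Conv t t' → Conv u u' → Conv (t.pair u) (t'.pair u')
  | fst {Γ : List Ty} {A B : Ty} {t t' : Tm Γ (Ty.prod A B)} :
      Conv t t' → Conv t.fst t'.fst
  | snd {Γ : List Ty} {A B : Ty} {t t' : Tm Γ (Ty.prod A B)} :
      Conv t t' → Conv t.snd t'.snd
  | lam {Γ : List Ty} {A B : Ty} {t t' : Tm (A :: Γ) B} :
      Conv t t' → Conv t.lam t'.lam
  | beta {Γ : List Ty} {A B : Ty} (t : Tm (A :: Γ) B) (u : Tm Γ A) :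
      Conv (t.lam.app u) (t.inst u)
  | fst_pair {Γ : List Ty} {A B : Ty} (t : Tm Γ A) (u : Tm Γ B) : Conv (t.pair u).fst t
  | snd_pair {Γ : List Ty} {A B : Ty} (t : Tm Γ A) (u : Tm Γ B) : Conv (t.pair u).snd u
  | rec_zero {Γ : List Ty} {A : Ty} (u : Tm Γ A)
      (v : Tm Γ (Ty.arrow Ty.nat (Ty.arrow A A))) :
      Conv ((((Tm.recn A).app u).app v).app Tm.zero) u
  | rec_suc {Γ : List Ty} {A : Ty} (u : Tm Γ A)
      (v : Tm Γ (Ty.arrow Ty.nat (Ty.arrow A A))) (t : Tm Γ Ty.nat) :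
      Conv ((((Tm.recn A).app u).app v).app t.suc)
        ((v.app t).app ((((Tm.recn A).app u).app v).app t))
  | cond_tt {Γ : List Ty} {A : Ty} (u v : Tm Γ A) :
      Conv ((((Tm.cond A).app Tm.tt).app u).app v) u
  | cond_ff {Γ : List Ty} {A : Ty} (u v : Tm Γ A) :
      Conv ((((Tm.cond A).app Tm.ff).app u).app v) v

/-- The numeral of `n`. -/
def num {Γ : List Ty} : ℕ → Tm Γ Ty.nat
  | 0 => Tm.zero
  | n + 1 => Tm.suc (num n)

/-- The type `N → N`. -/
abbrev nn : Ty := Ty.arrow Ty.nat Ty.nat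

/-- `fns k B` is the type `(N → N) → ⋯ → (N → N) → B` with `k` arguments of type `N → N`. -/
def fns : ℕ → Ty → Ty
  | 0, B => B
  | k + 1, B => Ty.arrow nn (fns k B)

/-- `t.apps f` is `t f₁ … f_k`. -/
def Tm.apps {B : Ty} : {k : ℕ} → Tm [] (fns k B) → (Fin k → Tm [] nn) → Tm [] B
  | 0, t, _ => t
  | _ + 1, t, f => Tm.apps (Tm.app t (f 0)) (fun i => f i.succ)

/-- The closed term `U : (N → N)^k → N` is a `k`-ary typed update procedure, with respect to the
coding `c` of `ℕ³ ∪ {∅}` by natural numbers (`none` stands for `∅`). In the second condition the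
index `i : Fin k` stands for the component with number `i + 1`. -/
structure IsUpdateProcedure (c : Option (ℕ × ℕ × ℕ) ≃ ℕ) (k : ℕ) (U : Tm [] (fns k Ty.nat)) :
    Prop where
  index_mem : ∀ (f : Fin k → Tm [] nn) (i n m : ℕ),
    Conv (U.apps f) (num (c (some (i, n, m)))) → 1 ≤ i ∧ i ≤ k
  stable : ∀ (f g : Fin k → Tm [] nn) (i : Fin k) (n m h l : ℕ),
    (∀ j : Fin k, j < i → Conv (f j) (g j)) →
    Conv (U.apps f) (num (c (some ((i : ℕ) + 1, n, m)))) →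
    Conv ((g i).app (num n)) (num m) →
    Conv (U.apps g) (num (c (some ((i : ℕ) + 1, h, l)))) →
    h ≠ n

/-- The closed terms `f₁, …, f_k` are a zero of `U`: `U f₁ … f_k = |∅|`. -/
def IsZero (c : Option (ℕ × ℕ × ℕ) ≃ ℕ) (k : ℕ) (U : Tm [] (fns k Ty.nat))
    (f : Fin k → Tm [] nn) : Prop :=
  Conv (U.apps f) (num (c none))

/-- Gödel numbers of types. -/
def Ty.code : Ty → ℕ
  | Ty.nat => Nat.pair 0 0 + 1
  | Ty.bool => Nat.pair 1 0 + 1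
  | Ty.prod A B => Nat.pair 2 (Nat.pair A.code B.code) + 1
  | Ty.arrow A B => Nat.pair 3 (Nat.pair A.code B.code) + 1

/-- The de Bruijn index of a variable. -/
def Var.index : {Γ : List Ty} → {A : Ty} → Var Γ A → ℕ
  | _, _, Var.zero => 0
  | _, _, Var.succ x => x.index + 1

/-- Gödel numbers of terms. -/
def Tm.code : {Γ : List Ty} → {A : Ty} → Tm Γ A → ℕ
  | _, _, Tm.var x => Nat.pair 0 x.index + 1
  | _, _, Tm.zero => Nat.pair 1 0 + 1
  | _, _, Tm.tt => Nat.pair 2 0 + 1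
  | _, _, Tm.ff => Nat.pair 3 0 + 1
  | _, _, Tm.cond A => Nat.pair 4 A.code + 1
  | _, _, Tm.recn A => Nat.pair 5 A.code + 1
  | _, _, Tm.suc t => Nat.pair 6 t.code + 1
  | _, _, Tm.app t u => Nat.pair 7 (Nat.pair t.code u.code) + 1
  | _, _, Tm.fst t => Nat.pair 8 t.code + 1
  | _, _, Tm.snd t => Nat.pair 9 t.code + 1
  | _, _, Tm.pair t u => Nat.pair 10 (Nat.pair t.code u.code) + 1
  | _, _, Tm.lam (A := A) t => Nat.pair 11 (Nat.pair A.code t.code) + 1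

theorem Ty.code_inj : ∀ {A B : Ty}, A.code = B.code → A = B := by
  intro A
  induction A with
  | nat => intro B h; cases B <;> simp [Ty.code, Nat.pair_eq_pair] at h ⊢
  | bool => intro B h; cases B <;> simp [Ty.code, Nat.pair_eq_pair] at h ⊢
  | prod A₁ A₂ h₁ h₂ =>
    intro B h
    cases B <;> simp [Ty.code, Nat.pair_eq_pair] at h ⊢
    exact ⟨h₁ h.1, h₂ h.2⟩
  | arrow A₁ A₂ h₁ h₂ =>
    intro B h
    cases B <;> simp [Ty.code, Nat.pair_eq_pair] at h ⊢
    exact ⟨h₁ h.1, h₂ h.2⟩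

theorem Var.index_inj : ∀ {Γ : List Ty} {A B : Ty} (x : Var Γ A) (y : Var Γ B),
    x.index = y.index → A = B ∧ HEq x y := by
  intro Γ A B x
  induction x with
  | zero => intro y h; cases y <;> simp [Var.index] at h ⊢
  | succ x ih =>
    intro y h
    cases y with
    | zero => simp [Var.index] at h
    | succ y =>
      simp only [Var.index, Nat.add_right_cancel_iff] at h
      obtain ⟨rfl, hxy⟩ := ih y h
      obtain rfl := eq_of_heq hxy
      exact ⟨rfl, HEq.rfl⟩

/-- A term (and its type) can be recovered from its Gödel number and its context. -/
theorem Tm.code_inj : ∀ {Γ : List Ty} {A B : Ty} (t : Tm Γ A) (u : Tm Γ B),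
    t.code = u.code → A = B ∧ HEq t u := by
  intro Γ A B t
  induction t generalizing B with
  | var x =>
    intro u h
    cases u <;> simp [Tm.code, Nat.pair_eq_pair] at h
    obtain ⟨rfl, hx⟩ := Var.index_inj _ _ h
    obtain rfl := eq_of_heq hx
    exact ⟨rfl, HEq.rfl⟩
  | zero => intro u h; cases u <;> simp [Tm.code, Nat.pair_eq_pair] at h ⊢
  | tt => intro u h; cases u <;> simp [Tm.code, Nat.pair_eq_pair] at h ⊢
  | ff => intro u h; cases u <;> simp [Tm.code, Nat.pair_eq_pair] at h ⊢
  | cond A =>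
    intro u h
    cases u <;> simp [Tm.code, Nat.pair_eq_pair] at h
    obtain rfl := Ty.code_inj h
    exact ⟨rfl, HEq.rfl⟩
  | recn A =>
    intro u h
    cases u <;> simp [Tm.code, Nat.pair_eq_pair] at h
    obtain rfl := Ty.code_inj h
    exact ⟨rfl, HEq.rfl⟩
  | suc t ih =>
    intro u h
    cases u <;> simp [Tm.code, Nat.pair_eq_pair] at h
    obtain ⟨-, ht⟩ := ih _ h
    obtain rfl := eq_of_heq ht
    exact ⟨rfl, HEq.rfl⟩
  | app t s iht ihs =>
    intro u h
    cases u <;> simp [Tm.code, Nat.pair_eq_pair] at h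
    obtain ⟨hT, ht⟩ := iht _ h.1
    obtain ⟨-, hs⟩ := ihs _ h.2
    cases hT
    obtain rfl := eq_of_heq ht
    obtain rfl := eq_of_heq hs
    exact ⟨rfl, HEq.rfl⟩
  | fst t ih =>
    intro u h
    cases u <;> simp [Tm.code, Nat.pair_eq_pair] at h
    obtain ⟨hT, ht⟩ := ih _ h
    cases hT
    obtain rfl := eq_of_heq ht
    exact ⟨rfl, HEq.rfl⟩
  | snd t ih =>
    intro u h
    cases u <;> simp [Tm.code, Nat.pair_eq_pair] at h
    obtain ⟨hT, ht⟩ := ih _ h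
    cases hT
    obtain rfl := eq_of_heq ht
    exact ⟨rfl, HEq.rfl⟩
  | pair t s iht ihs =>
    intro u h
    cases u <;> simp [Tm.code, Nat.pair_eq_pair] at h
    obtain ⟨rfl, ht⟩ := iht _ h.1
    obtain ⟨rfl, hs⟩ := ihs _ h.2
    obtain rfl := eq_of_heq ht
    obtain rfl := eq_of_heq hs
    exact ⟨rfl, HEq.rfl⟩
  | lam t ih =>
    intro u h
    cases u <;> simp [Tm.code, Nat.pair_eq_pair] at h
    obtain rfl := Ty.code_inj h.1
    obtain ⟨rfl, ht⟩ := ih _ h.2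
    obtain rfl := eq_of_heq ht
    exact ⟨rfl, HEq.rfl⟩

end SystemT

/-! A closed term of type `N` is provably equal to the numeral of its value in the set-theoretic
model and to no other (`conv_num_iff`), so the argument is about values.

Let `u` be the value of `U f₁ … f_k`. On each input function, `u` asks finitely many questions,
organised in a well-founded dialogue tree. A zero is learned by starting with the constant 0 and
following updates. By stability, a value that has been proposed is never replaced, so backtracking
along the tree needs one revision per query: at the query `n`, run the subtree for the current
value; if this changes the state at `n`, run the subtree for the new value, starting from the new
state. The value at `n` has now been proposed and is final. The invariant `run_spec` shows that this
ends in a state for which `u` proposes no update of the component in question.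

The tree is not an object of T, but running it is. In a continuation-passing translation with states
`N → N` transformed into states as answers, base types become computations. The logical relation
`rel_sem` shows that the translated functional, applied to a generic function, runs a dialogue tree
of `u`. Hence the learned state is the value of a term of T, uniformly in the parameters
(`zeroTm_spec`).

For several arguments, the last one is learned with the others as parameters. Substituting the
result gives a procedure that never proposes the last component, hence an update procedure with one
argument less (`IsUpdateProcedure.elimLast`). With no arguments left, only `∅` is a possible answer.
All terms arise by recursion on syntax and on `k`, so their Gödel numbers are primitive recursive in
the data. -/

namespace SystemT

/-! ### The standard model -/

/-- The set-theoretic interpretation of types. -/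
@[reducible] def Ty.sem : Ty → Type
  | Ty.nat => ℕ
  | Ty.bool => Bool
  | Ty.prod A B => A.sem × B.sem
  | Ty.arrow A B => A.sem → B.sem

/-- Environments of a context. -/
@[reducible] def Env : List Ty → Type
  | [] => Unit
  | A :: Γ => A.sem × Env Γ

def Var.sem : {Γ : List Ty} → {A : Ty} → Var Γ A → Env Γ → A.sem
  | _, _, Var.zero, ρ => ρ.1
  | _, _, Var.succ x, ρ => x.sem ρ.2

/-- The set-theoretic interpretation of terms. -/
def Tm.sem : {Γ : List Ty} → {A : Ty} → Tm Γ A → Env Γ → A.sem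
  | _, _, Tm.var x, ρ => x.sem ρ
  | _, _, Tm.zero, _ => (0 : ℕ)
  | _, _, Tm.tt, _ => true
  | _, _, Tm.ff, _ => false
  | _, _, Tm.cond _, _ => fun b x y => bif b then x else y
  | _, _, Tm.recn A, _ => fun a f n => Nat.rec (motive := fun _ => A.sem) a (fun m x => f m x) n
  | _, _, Tm.suc t, ρ => Nat.succ (t.sem ρ)
  | _, _, Tm.app t u, ρ => t.sem ρ (u.sem ρ)
  | _, _, Tm.fst t, ρ => (t.sem ρ).1
  | _, _, Tm.snd t, ρ => (t.sem ρ).2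
  | _, _, Tm.pair t u, ρ => (t.sem ρ, u.sem ρ)
  | _, _, Tm.lam t, ρ => fun a => t.sem (a, ρ)

theorem Tm.sem_rename {Γ : List Ty} {A : Ty} (t : Tm Γ A) :
    ∀ {Δ : List Ty} (r : Ren Γ Δ) (γ : Env Γ) (δ : Env Δ),
      (∀ B (x : Var Γ B), (r B x).sem δ = x.sem γ) → (t.rename r).sem δ = t.sem γ := by
  induction t with
  | var x => intro Δ r γ δ h; exact h _ x
  | zero | tt | ff | cond | recn => intros; rfl
  | suc t ih | fst t ih | snd t ih =>
    intro Δ r γ δ h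
    simp only [Tm.rename, Tm.sem, ih r γ δ h]
  | app t u iht ihu | pair t u iht ihu =>
    intro Δ r γ δ h
    simp only [Tm.rename, Tm.sem, iht r γ δ h, ihu r γ δ h]
  | lam t ih =>
    intro Δ r γ δ h
    funext a
    refine ih (r.lift _) (a, γ) (a, δ) fun B x => ?_
    cases x with
    | zero => rfl
    | succ x => exact h _ x

theorem Tm.sem_subst {Γ : List Ty} {A : Ty} (t : Tm Γ A) :
    ∀ {Δ : List Ty} (σ : Sub Γ Δ) (γ : Env Γ) (δ : Env Δ),
      (∀ B (x : Var Γ B), (σ B x).sem δ = x.sem γ) → (t.subst σ).sem δ = t.sem γ := by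
  induction t with
  | var x => intro Δ r γ δ h; exact h _ x
  | zero | tt | ff | cond | recn => intros; rfl
  | suc t ih | fst t ih | snd t ih =>
    intro Δ r γ δ h
    simp only [Tm.subst, Tm.sem, ih r γ δ h]
  | app t u iht ihu | pair t u iht ihu =>
    intro Δ r γ δ h
    simp only [Tm.subst, Tm.sem, iht r γ δ h, ihu r γ δ h]
  | lam t ih =>
    intro Δ σ γ δ h
    funext a
    refine ih (σ.lift _) (a, γ) (a, δ) fun B x => ?_
    cases x with
    | zero => rfl
    | succ x => exact (Tm.sem_rename (σ B x) (fun _ y => Var.succ y) δ (a, δ) fun _ _ => rfl).trans (h _ x)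

theorem Tm.sem_inst {Γ : List Ty} {A B : Ty} (t : Tm (B :: Γ) A) (u : Tm Γ B) (γ : Env Γ) :
    (t.inst u).sem γ = t.sem (u.sem γ, γ) := by
  refine t.sem_subst _ (u.sem γ, γ) γ fun C x => ?_
  cases x <;> rfl

/-- Provably equal terms have the same interpretation. -/
theorem Conv.sem_eq {Γ : List Ty} {A : Ty} {t u : Tm Γ A} (h : Conv t u) :
    ∀ γ, t.sem γ = u.sem γ := by
  induction h with
  | refl => intro; rfl
  | symm _ ih => intro γ; exact (ih γ).symm
  | trans _ _ ih₁ ih₂ => intro γ; exact (ih₁ γ).trans (ih₂ γ)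
  | suc _ ih | fst _ ih | snd _ ih => intro γ; simp only [Tm.sem, ih γ]
  | app _ _ ih₁ ih₂ | pair _ _ ih₁ ih₂ => intro γ; simp only [Tm.sem, ih₁ γ, ih₂ γ]
  | lam _ ih => intro γ; funext a; exact ih (a, γ)
  | beta t u => intro γ; exact (t.sem_inst u γ).symm
  | fst_pair | snd_pair | rec_zero | rec_suc | cond_tt | cond_ff => intros; rfl

theorem sem_num {Γ : List Ty} (n : ℕ) (γ : Env Γ) : (num n : Tm Γ Ty.nat).sem γ = n := by
  induction n with
  | zero => rfl
  | succ n ih => exact congrArg Nat.succ ih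

/-! ### Substitution calculus -/

theorem Tm.rename_subst {Γ : List Ty} {A : Ty} (t : Tm Γ A) :
    ∀ {Δ Θ : List Ty} (r : Ren Γ Δ) (σ : Sub Δ Θ) (τ : Sub Γ Θ),
      (∀ B (x : Var Γ B), σ B (r B x) = τ B x) → (t.rename r).subst σ = t.subst τ := by
  induction t with
  | var x => intro Δ Θ r σ τ h; exact h _ x
  | zero | tt | ff | cond | recn => intros; rfl
  | suc t ih | fst t ih | snd t ih =>
    intro Δ Θ r σ τ h
    simp only [Tm.rename, Tm.subst, ih r σ τ h]
  | app t u iht ihu | pair t u iht ihu =>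
    intro Δ Θ r σ τ h
    simp only [Tm.rename, Tm.subst, iht r σ τ h, ihu r σ τ h]
  | lam t ih =>
    intro Δ Θ r σ τ h
    refine congrArg Tm.lam (ih _ _ _ fun B x => ?_)
    cases x with
    | zero => rfl
    | succ x => exact congrArg (fun s => Tm.rename s _) (h _ x)

theorem Tm.subst_var {Γ : List Ty} {A : Ty} (t : Tm Γ A) :
    ∀ σ : Sub Γ Γ, (∀ B (x : Var Γ B), σ B x = Tm.var x) → t.subst σ = t := by
  induction t with
  | var x => intro σ h; exact h _ x
  | zero | tt | ff | cond | recn => intros; rfl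
  | suc t ih | fst t ih | snd t ih => intro σ h; simp only [Tm.subst, ih σ h]
  | app t u iht ihu | pair t u iht ihu => intro σ h; simp only [Tm.subst, iht σ h, ihu σ h]
  | lam t ih =>
    intro σ h
    refine congrArg Tm.lam (ih _ fun B x => ?_)
    cases x with
    | zero => rfl
    | succ x => exact congrArg (fun s => Tm.rename s _) (h _ x)

theorem Tm.rename_rename {Γ : List Ty} {A : Ty} (t : Tm Γ A) :
    ∀ {Δ Θ : List Ty} (r : Ren Γ Δ) (s : Ren Δ Θ) (q : Ren Γ Θ),
      (∀ B (x : Var Γ B), s B (r B x) = q B x) → (t.rename r).rename s = t.rename q := by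
  induction t with
  | var x => intro Δ Θ r s q h; exact congrArg Tm.var (h _ x)
  | zero | tt | ff | cond | recn => intros; rfl
  | suc t ih | fst t ih | snd t ih =>
    intro Δ Θ r s q h
    simp only [Tm.rename, ih r s q h]
  | app t u iht ihu | pair t u iht ihu =>
    intro Δ Θ r s q h
    simp only [Tm.rename, iht r s q h, ihu r s q h]
  | lam t ih =>
    intro Δ Θ r s q h
    refine congrArg Tm.lam (ih _ _ _ fun B x => ?_)
    cases x with
    | zero => rfl
    | succ x => exact congrArg Var.succ (h _ x)

theorem Tm.subst_rename {Γ : List Ty} {A : Ty} (t : Tm Γ A) :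
    ∀ {Δ Θ : List Ty} (σ : Sub Γ Δ) (r : Ren Δ Θ) (τ : Sub Γ Θ),
      (∀ B (x : Var Γ B), (σ B x).rename r = τ B x) → (t.subst σ).rename r = t.subst τ := by
  induction t with
  | var x => intro Δ Θ r σ τ h; exact h _ x
  | zero | tt | ff | cond | recn => intros; rfl
  | suc t ih | fst t ih | snd t ih =>
    intro Δ Θ σ r τ h
    simp only [Tm.rename, Tm.subst, ih σ r τ h]
  | app t u iht ihu | pair t u iht ihu =>
    intro Δ Θ σ r τ h
    simp only [Tm.rename, Tm.subst, iht σ r τ h, ihu σ r τ h]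
  | lam t ih =>
    intro Δ Θ σ r τ h
    refine congrArg Tm.lam (ih _ _ _ fun B x => ?_)
    cases x with
    | zero => rfl
    | succ x =>
      refine Eq.trans ?_ (congrArg (fun s => Tm.rename s _) (h _ x))
      exact (Tm.rename_rename (σ B x) (fun _ y => Var.succ y) _ (fun C y => Var.succ (r C y)) fun _ _ => rfl).trans
        (Tm.rename_rename (σ B x) r (fun _ y => Var.succ y) _ fun _ _ => rfl).symm

theorem Tm.subst_subst {Γ : List Ty} {A : Ty} (t : Tm Γ A) :
    ∀ {Δ Θ : List Ty} (σ : Sub Γ Δ) (τ : Sub Δ Θ) (υ : Sub Γ Θ),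
      (∀ B (x : Var Γ B), (σ B x).subst τ = υ B x) → (t.subst σ).subst τ = t.subst υ := by
  induction t with
  | var x => intro Δ Θ r σ τ h; exact h _ x
  | zero | tt | ff | cond | recn => intros; rfl
  | suc t ih | fst t ih | snd t ih =>
    intro Δ Θ σ r τ h
    simp only [Tm.subst, ih σ r τ h]
  | app t u iht ihu | pair t u iht ihu =>
    intro Δ Θ σ r τ h
    simp only [Tm.subst, iht σ r τ h, ihu σ r τ h]
  | lam t ih =>
    intro Δ Θ σ τ υ h
    refine congrArg Tm.lam (ih _ _ _ fun B x => ?_)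
    cases x with
    | zero => rfl
    | succ x =>
      refine Eq.trans ?_ (congrArg (fun s => Tm.rename s _) (h _ x))
      exact (Tm.rename_subst (σ B x) _ _ (fun C y => (τ C y).rename fun _ z => Var.succ z)
        fun _ _ => rfl).trans (Tm.subst_rename (σ B x) _ _ _ fun _ _ => rfl).symm

/-- Extension of a substitution by a term. -/
def Sub.cons {Γ Δ : List Ty} {B : Ty} (u : Tm Δ B) (σ : Sub Γ Δ) : Sub (B :: Γ) Δ
  | _, Var.zero => u
  | _, Var.succ x => σ _ x

theorem Tm.inst_subst_lift {Γ Δ : List Ty} {A B : Ty} (t : Tm (B :: Γ) A) (σ : Sub Γ Δ)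
    (u : Tm Δ B) : (t.subst (σ.lift B)).inst u = t.subst (Sub.cons u σ) := by
  refine t.subst_subst _ _ _ fun C x => ?_
  cases x with
  | zero => rfl
  | succ x =>
    exact (Tm.rename_subst (σ C x) (fun _ y => Var.succ y) _ (fun _ y => Tm.var y) fun _ _ => rfl).trans
      (Tm.subst_var (σ C x) _ fun _ _ => rfl)

/-! ### Canonicity -/

/-- Tait's computability predicate for closed terms. -/
def Red : (A : Ty) → Tm [] A → Prop
  | Ty.nat, t => ∃ n, Conv t (num n)
  | Ty.bool, t => Conv t Tm.tt ∨ Conv t Tm.ff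
  | Ty.prod A B, t => Red A t.fst ∧ Red B t.snd
  | Ty.arrow A B, t => ∀ u, Red A u → Red B (t.app u)

theorem Red.of_conv : ∀ {A : Ty} {t u : Tm [] A}, Conv t u → Red A u → Red A t
  | Ty.nat, _, _, h, ⟨n, hn⟩ => ⟨n, h.trans hn⟩
  | Ty.bool, _, _, h, hu => hu.imp h.trans h.trans
  | Ty.prod _ _, _, _, h, hu => ⟨Red.of_conv h.fst hu.1, Red.of_conv h.snd hu.2⟩
  | Ty.arrow _ _, _, _, h, hu => fun v hv => Red.of_conv (h.app (Conv.refl v)) (hu v hv)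

/-- Induction on the term; the generality over substitutions is what the abstraction case consumes.
For the recursor, the argument is first converted to a numeral, on which a second induction runs. -/
theorem red_subst {Γ : List Ty} {A : Ty} (t : Tm Γ A) :
    ∀ σ : Sub Γ [], (∀ B (x : Var Γ B), Red B (σ B x)) → Red A (t.subst σ) := by
  induction t with
  | var x => intro σ h; exact h _ x
  | zero => intro σ h; exact ⟨0, Conv.refl _⟩
  | tt => intro σ h; exact Or.inl (Conv.refl _)
  | ff => intro σ h; exact Or.inr (Conv.refl _)
  | cond A =>
    intro σ h b hb u hu v hv
    rcases hb with hb | hb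
    · exact Red.of_conv ((((Conv.refl _).app hb).app (Conv.refl u)).app (Conv.refl v)
        |>.trans (Conv.cond_tt u v)) hu
    · exact Red.of_conv ((((Conv.refl _).app hb).app (Conv.refl u)).app (Conv.refl v)
        |>.trans (Conv.cond_ff u v)) hv
  | recn A =>
    intro σ h u hu v hv t ht
    obtain ⟨n, hn⟩ := ht
    refine Red.of_conv ((Conv.refl _).app hn) ?_
    clear hn
    induction n with
    | zero => exact Red.of_conv (Conv.rec_zero u v) hu
    | succ n ih => exact Red.of_conv (Conv.rec_suc u v (num n)) (hv _ ⟨n, Conv.refl _⟩ _ ih)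
  | suc t ih =>
    intro σ h
    obtain ⟨n, hn⟩ := ih σ h
    exact ⟨n + 1, hn.suc⟩
  | fst t ih => intro σ h; exact (ih σ h).1
  | snd t ih => intro σ h; exact (ih σ h).2
  | app t u iht ihu => intro σ h; exact iht σ h _ (ihu σ h)
  | pair t u iht ihu =>
    intro σ h
    exact ⟨Red.of_conv (Conv.fst_pair _ _) (iht σ h), Red.of_conv (Conv.snd_pair _ _) (ihu σ h)⟩
  | lam t ih =>
    intro σ h u hu
    refine Red.of_conv (Conv.beta _ _) ?_
    rw [Tm.inst_subst_lift]
    refine ih _ fun B x => ?_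
    cases x with
    | zero => exact hu
    | succ x => exact h _ x

/-- The value of a closed term in the standard model. -/
def Tm.val {A : Ty} (t : Tm [] A) : A.sem := t.sem ()

/-- A closed term of type `N` is provably equal to the numeral of its value only. -/
theorem conv_num_iff (t : Tm [] Ty.nat) (n : ℕ) : Conv t (num n) ↔ t.val = n := by
  constructor
  · intro h
    exact (h.sem_eq ()).trans (sem_num (Γ := []) n ())
  · intro h
    -- Computability yields some numeral; soundness of the model identifies it.
    obtain ⟨m, hm⟩ : Red Ty.nat t := by
      rw [← t.subst_var (fun _ x => Tm.var x) fun _ _ => rfl]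
      exact red_subst t _ fun B x => nomatch x
    have : t.val = m := (hm.sem_eq ()).trans (sem_num (Γ := []) m ())
    rw [← h, this]
    exact hm

/-- Application, as an infix. -/
local infixl:70 " ⬝ " => Tm.app

abbrev v0 {Γ : List Ty} {A : Ty} : Tm (A :: Γ) A := Tm.var Var.zero
abbrev v1 {Γ : List Ty} {A B : Ty} : Tm (B :: A :: Γ) A := Tm.var (Var.succ Var.zero)
abbrev v2 {Γ : List Ty} {A B C : Ty} : Tm (C :: B :: A :: Γ) A :=
  Tm.var (Var.succ (Var.succ Var.zero))
abbrev v3 {Γ : List Ty} {A B C D : Ty} : Tm (D :: C :: B :: A :: Γ) A :=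
  Tm.var (Var.succ (Var.succ (Var.succ Var.zero)))

/-! ### Primitive recursive functions are definable -/

/-- The type of `n`-tuples of natural numbers. -/
def tup : ℕ → Ty
  | 0 => Ty.nat
  | n + 1 => Ty.prod Ty.nat (tup n)

def tupVal : {n : ℕ} → (tup n).sem → List.Vector ℕ n
  | 0, _ => List.Vector.nil
  | _ + 1, v => List.Vector.cons v.1 (tupVal v.2)

/-- Here and below, a family of terms over all contexts takes the place of a closed term, which
permits its use under binders without weakening. -/
theorem exists_tm_get {n : ℕ} (i : Fin n) :
    ∃ t : ∀ Γ, Tm Γ (Ty.arrow (tup n) Ty.nat), ∀ Γ ρ v, (t Γ).sem ρ v = (tupVal v).get i := by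
  induction n with
  | zero => exact i.elim0
  | succ n ih =>
    refine Fin.cases ⟨fun Γ => Tm.lam (Tm.fst v0), fun Γ ρ v => rfl⟩ (fun j => ?_) i
    obtain ⟨t, ht⟩ := ih j
    refine ⟨fun Γ => Tm.lam (t _ ⬝ Tm.snd v0), fun Γ ρ v => ?_⟩
    exact (ht _ _ v.2).trans (List.Vector.get_cons_succ _ _ _).symm

theorem exists_tm_ofFn {n : ℕ} : ∀ {m : ℕ} {g : Fin m → List.Vector ℕ n → ℕ},
    (∀ i, ∃ t : ∀ Γ, Tm Γ (Ty.arrow (tup n) Ty.nat), ∀ Γ ρ v, (t Γ).sem ρ v = g i (tupVal v)) →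
    ∃ t : ∀ Γ, Tm Γ (Ty.arrow (tup n) (tup m)),
      ∀ Γ ρ v, tupVal ((t Γ).sem ρ v) = List.Vector.ofFn fun i => g i (tupVal v)
  -- There is no unit type: any number represents the empty tuple.
  | 0, _, _ => ⟨fun Γ => Tm.lam Tm.zero, fun _ _ _ => rfl⟩
  | m + 1, g, h => by
    obtain ⟨t, ht⟩ := h 0
    obtain ⟨u, hu⟩ := exists_tm_ofFn fun i : Fin m => h i.succ
    refine ⟨fun Γ => Tm.lam (Tm.pair (t _ ⬝ v0) (u _ ⬝ v0)), fun Γ ρ v => ?_⟩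
    exact congrArg₂ List.Vector.cons (ht _ _ v) (hu _ _ v)

theorem exists_tm_of_primrec' {n : ℕ} {f : List.Vector ℕ n → ℕ} (hf : Nat.Primrec' f) :
    ∃ t : ∀ Γ, Tm Γ (Ty.arrow (tup n) Ty.nat), ∀ Γ ρ v, (t Γ).sem ρ v = f (tupVal v) := by
  induction hf with
  | zero => exact ⟨fun Γ => Tm.lam Tm.zero, fun _ _ _ => rfl⟩
  | succ => exact ⟨fun Γ => Tm.lam (Tm.suc (Tm.fst v0)), fun _ _ _ => rfl⟩
  | get i => exact exists_tm_get i
  | comp g _ _ ihf ihg =>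
    obtain ⟨t, ht⟩ := ihf
    obtain ⟨u, hu⟩ := exists_tm_ofFn ihg
    refine ⟨fun Γ => Tm.lam (t _ ⬝ (u _ ⬝ v0)), fun Γ ρ v => ?_⟩
    exact (ht _ _ _).trans (congrArg _ (hu _ _ v))
  | @prec n f g _ _ ihf ihg =>
    obtain ⟨t, ht⟩ := ihf
    obtain ⟨u, hu⟩ := ihg
    refine ⟨fun Γ => Tm.lam (Tm.recn Ty.nat ⬝ (t _ ⬝ Tm.snd v0) ⬝
      Tm.lam (Tm.lam (u _ ⬝ Tm.pair v1 (Tm.pair v0 (Tm.snd v2)))) ⬝ Tm.fst v0),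
      fun Γ ρ v => ?_⟩
    obtain ⟨m, w⟩ := v
    -- The actual environment contains the recursion argument, so it is decoupled from `m` before
    -- the induction.
    have key (ρ' : Env (tup (n + 1) :: Γ)) (m : ℕ) :
        Nat.rec (motive := fun _ => ℕ) ((t _).sem ρ' w)
          (fun y a => (u (Ty.nat :: Ty.nat :: _)).sem (a, y, ρ') (y, a, w)) m =
        Nat.rec (motive := fun _ => ℕ) (f (tupVal w))
          (fun y a => g (List.Vector.cons y (List.Vector.cons a (tupVal w)))) m := by
      induction m with
      | zero => exact ht _ _ w
      | succ m ih =>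
        refine (hu _ _ _).trans ?_
        exact congrArg (fun a => g (List.Vector.cons m (List.Vector.cons a (tupVal w)))) ih
    exact key ((m, w), ρ) m

/-- A primitive recursive function of four arguments is the value of a term. -/
theorem exists_tm_of_primrec₄ {f : ℕ → ℕ → ℕ → ℕ → ℕ}
    (hf : Primrec fun p : ℕ × ℕ × ℕ × ℕ => f p.1 p.2.1 p.2.2.1 p.2.2.2) :
    ∃ t : ∀ Γ, Tm Γ (Ty.arrow Ty.nat (Ty.arrow Ty.nat (Ty.arrow Ty.nat nn))),
      ∀ Γ ρ, (t Γ).sem ρ = f := by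
  have h : Primrec fun v : List.Vector ℕ 4 => f (v.get 0) (v.get 1) (v.get 2) (v.get 3) := by
    have hg (i : Fin 4) : Primrec fun v : List.Vector ℕ 4 => v.get i :=
      Primrec.vector_get.comp Primrec.id (Primrec.const i)
    exact hf.comp (Primrec.pair (hg 0) (Primrec.pair (hg 1) (Primrec.pair (hg 2) (hg 3))))
  obtain ⟨t, ht⟩ := exists_tm_of_primrec' (Nat.Primrec'.of_prim h)
  refine ⟨fun Γ => Tm.lam (Tm.lam (Tm.lam (Tm.lam
    (t _ ⬝ Tm.pair v3 (Tm.pair v2 (Tm.pair v1 (Tm.pair v0 Tm.zero))))))), fun Γ ρ => ?_⟩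
  funext a b c d
  exact ht _ _ _

/-! ### The continuation-passing translation -/

/-- The answer type of the translation: transformations of states, where a state is a
function `N → N`. -/
abbrev ans : Ty := Ty.arrow nn nn

/-- The continuation monad with answer type `ans`. -/
abbrev cont (A : Ty) : Ty := Ty.arrow (Ty.arrow A ans) ans

/-- The translation of types: base types are replaced by computations. -/
@[reducible] def Ty.tr : Ty → Ty
  | Ty.nat => cont Ty.nat
  | Ty.bool => cont Ty.bool
  | Ty.prod A B => Ty.prod A.tr B.tr
  | Ty.arrow A B => Ty.arrow A.tr B.tr

/-- The extension of functions `b → A.tr` to computations of type `b`. -/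
def ext (b : Ty) : (A : Ty) → {Γ : List Ty} →
    Tm Γ (Ty.arrow (Ty.arrow b A.tr) (Ty.arrow (cont b) A.tr))
  -- At base types this is the bind of the continuation monad; at products and arrows it acts
  -- pointwise.
  | Ty.nat, _ => Tm.lam (Tm.lam (Tm.lam (v1 ⬝ Tm.lam (v3 ⬝ v0 ⬝ v1))))
  | Ty.bool, _ => Tm.lam (Tm.lam (Tm.lam (v1 ⬝ Tm.lam (v3 ⬝ v0 ⬝ v1))))
  | Ty.prod A B, _ => Tm.lam (Tm.lam (Tm.pair
      (ext b A ⬝ Tm.lam (Tm.fst (v2 ⬝ v0)) ⬝ v0) (ext b B ⬝ Tm.lam (Tm.snd (v2 ⬝ v0)) ⬝ v0)))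
  | Ty.arrow _ B, _ => Tm.lam (Tm.lam (Tm.lam (ext b B ⬝ Tm.lam (v3 ⬝ v0 ⬝ v1) ⬝ v1)))

def trSuc {Γ : List Ty} : Tm Γ (Ty.arrow (cont Ty.nat) (cont Ty.nat)) :=
  Tm.lam (Tm.lam (v1 ⬝ Tm.lam (v1 ⬝ Tm.suc v0)))

def trCond (A : Ty) {Γ : List Ty} :
    Tm Γ (Ty.arrow (cont Ty.bool) (Ty.arrow A.tr (Ty.arrow A.tr A.tr))) :=
  Tm.lam (Tm.lam (Tm.lam (ext Ty.bool A ⬝ Tm.lam (Tm.cond A.tr ⬝ v0 ⬝ v2 ⬝ v1) ⬝ v2)))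

/-- The recursor needs an actual number, which `ext` extracts from the computation; the step
function receives each number as the computation returning it at once. -/
def trRecn (A : Ty) {Γ : List Ty} : Tm Γ (Ty.arrow A.tr
    (Ty.arrow (Ty.arrow (cont Ty.nat) (Ty.arrow A.tr A.tr)) (Ty.arrow (cont Ty.nat) A.tr))) :=
  Tm.lam (Tm.lam (Tm.lam
    (ext Ty.nat A ⬝ (Tm.recn A.tr ⬝ v2 ⬝ Tm.lam (v2 ⬝ Tm.lam (v0 ⬝ v1))) ⬝ v0)))

def Var.tr : {Γ : List Ty} → {A : Ty} → Var Γ A → Var (Γ.map Ty.tr) A.tr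
  | _, _, Var.zero => Var.zero
  | _, _, Var.succ x => Var.succ x.tr

/-- The translation of terms. -/
def Tm.tr : {Γ : List Ty} → {A : Ty} → Tm Γ A → Tm (Γ.map Ty.tr) A.tr
  | _, _, Tm.var x => Tm.var x.tr
  | _, _, Tm.zero => Tm.lam (v0 ⬝ Tm.zero)
  | _, _, Tm.tt => Tm.lam (v0 ⬝ Tm.tt)
  | _, _, Tm.ff => Tm.lam (v0 ⬝ Tm.ff)
  | _, _, Tm.cond A => trCond A
  | _, _, Tm.recn A => trRecn A
  | _, _, Tm.suc t => trSuc ⬝ t.tr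
  | _, _, Tm.app t u => t.tr ⬝ u.tr
  | _, _, Tm.fst t => Tm.fst t.tr
  | _, _, Tm.snd t => Tm.snd t.tr
  | _, _, Tm.pair t u => Tm.pair t.tr u.tr
  | _, _, Tm.lam t => Tm.lam t.tr

/-- The translation of a given function. -/
def liftFn {Γ : List Ty} : Tm Γ (Ty.arrow nn nn.tr) :=
  Tm.lam (Tm.lam (Tm.lam (v1 ⬝ Tm.lam (v1 ⬝ (v3 ⬝ v0)))))

/-! ### Dialogue trees -/

/-- Well-founded trees of queries to a function, with answers in `S` at the leaves. -/
inductive Dialogue (S : Type) : Type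
  | leaf : S → Dialogue S
  | ask : ℕ → (ℕ → Dialogue S) → Dialogue S

/-- The answer when the queries are answered by `α`. -/
def Dialogue.eval {S : Type} (α : ℕ → ℕ) : Dialogue S → S
  | leaf a => a
  | ask n φ => (φ (α n)).eval α

def Dialogue.bind {S T : Type} (f : S → Dialogue T) : Dialogue S → Dialogue T
  | leaf a => f a
  | ask n φ => ask n fun v => (φ v).bind f

theorem Dialogue.eval_bind {S T : Type} (f : S → Dialogue T) (α : ℕ → ℕ) (D : Dialogue S) :
    (D.bind f).eval α = (f (D.eval α)).eval α := by
  induction D with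
  | leaf a => rfl
  | ask n φ ih => exact ih (α n)

/-- State transformations. -/
abbrev Trans : Type := (ℕ → ℕ) → ℕ → ℕ

/-- Query the current state at `n`; if the rest of the computation changes the state at `n`,
continue with the new value. -/
def query (n : ℕ) (k : ℕ → Trans) : Trans := fun s =>
  -- The second run starts from the state reached by the first, so nothing learned is lost.
  if k (s n) s n = s n then k (s n) s else k (k (s n) s n) (k (s n) s)

/-- The computation of a dialogue tree in the continuation monad. -/
def Dialogue.run {S : Type} (k : S → Trans) : Dialogue S → Trans
  | leaf a => k a
  | ask n φ => query n fun v => (φ v).run k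

theorem Dialogue.run_bind {S T : Type} (f : S → Dialogue T) (k : T → Trans) (D : Dialogue S) :
    (D.bind f).run k = D.run fun a => (f a).run k := by
  induction D with
  | leaf a => rfl
  | ask n φ ih => exact congrArg (query n) (funext ih)

/-! ### The logical relation between values depending on a function and computations -/

/-- The logical relation: at base types, both sides are given by one dialogue tree. -/
def Rel : (A : Ty) → ((ℕ → ℕ) → A.sem) → A.tr.sem → Prop
  | Ty.nat, x, d => ∃ D : Dialogue ℕ, (∀ α, x α = D.eval α) ∧ ∀ k, d k = D.run k
  | Ty.bool, x, d => ∃ D : Dialogue Bool, (∀ α, x α = D.eval α) ∧ ∀ k, d k = D.run k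
  | Ty.prod A B, x, d => Rel A (fun α => (x α).1) d.1 ∧ Rel B (fun α => (x α).2) d.2
  | Ty.arrow A B, x, d => ∀ y e, Rel A y e → Rel B (fun α => x α (y α)) (d e)

/-- At base types, the trees of the values `x v` are grafted onto the leaves of `D`. The context
varies because `ext` calls itself under binders. -/
theorem rel_ext {b A : Ty} {Γ : List Ty} {ρ : Env Γ} {x : b.sem → (ℕ → ℕ) → A.sem}
    {f : b.sem → A.tr.sem} (h : ∀ v, Rel A (x v) (f v)) {D : Dialogue b.sem}
    {d : (cont b).sem} (hd : ∀ k, d k = D.run k) :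
    Rel A (fun α => x (D.eval α) α) ((ext b A).sem ρ f d) := by
  induction A generalizing Γ with
  | nat | bool =>
    choose E hE hE' using h
    refine ⟨D.bind E, fun α => ?_, fun k => ?_⟩
    · rw [Dialogue.eval_bind]
      exact hE _ α
    · rw [Dialogue.run_bind]
      refine (hd _).trans (congrArg (fun k => Dialogue.run k D) (funext fun v => ?_))
      exact hE' v k
  | prod A B ihA ihB => exact ⟨ihA fun v => (h v).1, ihB fun v => (h v).2⟩
  | arrow A B _ ihB =>
    intro y e hy
    exact ihB (x := fun v α => x v α (y α)) fun v => h v y e hy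

/-- The fundamental lemma of the logical relation. -/
theorem rel_sem {Γ : List Ty} {A : Ty} (t : Tm Γ A) :
    ∀ (γ : (ℕ → ℕ) → Env Γ) (δ : Env (Γ.map Ty.tr)),
      (∀ B (x : Var Γ B), Rel B (fun α => x.sem (γ α)) (x.tr.sem δ)) →
      Rel A (fun α => t.sem (γ α)) (t.tr.sem δ) := by
  induction t with
  | var x => intro γ δ h; exact h _ x
  | zero => intro γ δ h; exact ⟨Dialogue.leaf 0, fun _ => rfl, fun _ => rfl⟩
  | tt => intro γ δ h; exact ⟨Dialogue.leaf true, fun _ => rfl, fun _ => rfl⟩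
  | ff => intro γ δ h; exact ⟨Dialogue.leaf false, fun _ => rfl, fun _ => rfl⟩
  | cond A =>
    rintro γ δ h b d ⟨D, hD, hd⟩ x e hx y e' hy
    have := rel_ext (A := A) (b := Ty.bool) (Γ := _ :: _ :: _ :: _) (ρ := (e', e, d, δ))
      (x := fun b α => bif b then x α else y α) (f := fun b => bif b then e else e')
      (by rintro (_ | _) <;> assumption) hd
    simp only [← hD] at this
    exact this
  | @recn Γ A =>
    rintro γ δ h a e ha f g hf n d ⟨D, hD, hd⟩
    -- For an actual number the iterates are related by induction; `rel_ext` passes to a computed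
    -- number.
    have := rel_ext (A := A) (b := Ty.nat) (Γ := _ :: _ :: _ :: _) (ρ := (d, g, e, δ))
      (x := fun n α => Nat.rec (motive := fun _ => A.sem) (a α) (fun m x => f α m x) n)
      (f := fun n => Nat.rec (motive := fun _ => A.tr.sem) e (fun m x => g (fun k => k m) x) n)
      (by
        intro n
        induction n with
        | zero => exact ha
        | succ n ih =>
          exact hf (fun _ => n) (fun k => k n) ⟨Dialogue.leaf n, fun _ => rfl, fun _ => rfl⟩ _ _ ih)
      hd
    simp only [← hD] at this
    exact this
  | suc t ih =>
    intro γ δ h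
    obtain ⟨D, hD, hd⟩ := ih γ δ h
    refine ⟨D.bind fun n => Dialogue.leaf (n + 1), fun α => ?_, fun k => ?_⟩
    · rw [Dialogue.eval_bind, ← hD]
      rfl
    · rw [Dialogue.run_bind]
      exact hd _
  | fst t ih => intro γ δ h; exact (ih γ δ h).1
  | snd t ih => intro γ δ h; exact (ih γ δ h).2
  | app t u iht ihu => intro γ δ h; exact iht γ δ h _ _ (ihu γ δ h)
  | pair t u iht ihu => intro γ δ h; exact ⟨iht γ δ h, ihu γ δ h⟩
  | lam t ih =>
    intro γ δ h y e hy
    refine ih (fun α => (y α, γ α)) (e, δ) fun B x => ?_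
    cases x with
    | zero => exact hy
    | succ x => exact h _ x

theorem rel_val {A : Ty} (t : Tm [] A) : Rel A (fun _ => t.val) t.tr.val :=
  rel_sem t (fun _ => ()) () fun _ x => nomatch x

theorem rel_liftFn (f : ℕ → ℕ) : Rel nn (fun _ => f) (liftFn (Γ := []).val f) := by
  rintro y e ⟨D, hD, hd⟩
  refine ⟨D.bind fun n => Dialogue.leaf (f n), fun α => ?_, fun k => ?_⟩
  · rw [Dialogue.eval_bind, ← hD]
    rfl
  · rw [Dialogue.run_bind]
    exact hd _

/-- The translation of a generic function, whose values are asked for. -/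
def generic : nn.tr.sem := fun d k => d fun n => query n k

/-- `query n` is the run of the one-question tree `Dialogue.ask n Dialogue.leaf`, which is grafted
onto the tree of the argument. -/
theorem rel_generic : Rel nn (fun α => α) generic := by
  rintro y e ⟨D, hD, hd⟩
  refine ⟨D.bind fun n => Dialogue.ask n Dialogue.leaf, fun α => ?_, fun k => ?_⟩
  · rw [Dialogue.eval_bind, ← hD]
    rfl
  · rw [Dialogue.run_bind]
    exact hd _

/-! ### Learning by backtracking along a dialogue tree -/

/-- The value at `x` of the state with value `v` at `x` after the update coded by `y`, if this
concerns the component `i`. -/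
def updateAt (c : Option (ℕ × ℕ × ℕ) ≃ ℕ) (i y x v : ℕ) : ℕ :=
  (c.symm y).elim v fun p => if p.1 = i ∧ p.2.1 = x then p.2.2 else v

theorem primrec_updateAt {c : Option (ℕ × ℕ × ℕ) ≃ ℕ} (hc : Primrec c.symm) :
    Primrec fun p : ℕ × ℕ × ℕ × ℕ => updateAt c p.1 p.2.1 p.2.2.1 p.2.2.2 := by
  have h₁ : Primrec fun p : (ℕ × ℕ × ℕ × ℕ) × ℕ × ℕ × ℕ => p.2.2.1 :=
    Primrec.fst.comp (Primrec.snd.comp Primrec.snd)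
  have h₂ : Primrec fun p : ℕ × ℕ × ℕ × ℕ => p.2.2.2 :=
    Primrec.snd.comp (Primrec.snd.comp Primrec.snd)
  have h₃ : Primrec fun p : ℕ × ℕ × ℕ × ℕ => p.2.2.1 :=
    Primrec.fst.comp (Primrec.snd.comp Primrec.snd)
  refine (Primrec.option_casesOn (hc.comp (Primrec.fst.comp Primrec.snd)) h₂
    (g := fun (p : ℕ × ℕ × ℕ × ℕ) (r : ℕ × ℕ × ℕ) =>
      if r.1 = p.1 ∧ r.2.1 = p.2.2.1 then r.2.2 else p.2.2.2) ?_).of_eq fun p => ?_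
  · exact Primrec.ite ((Primrec.eq.comp (Primrec.fst.comp Primrec.snd)
      (Primrec.fst.comp Primrec.fst)).and (Primrec.eq.comp h₁ (h₃.comp Primrec.fst)))
      (Primrec.snd.comp (Primrec.snd.comp Primrec.snd)) (h₂.comp Primrec.fst)
  · unfold updateAt
    cases c.symm p.2.1 <;> rfl

section Learning

variable {c : Option (ℕ × ℕ × ℕ) ≃ ℕ} {i : ℕ} {u : (ℕ → ℕ) → ℕ}

/-- The update of a state that `u` prescribes. -/
def improve (c : Option (ℕ × ℕ × ℕ) ≃ ℕ) (i : ℕ) (u : (ℕ → ℕ) → ℕ) : Trans :=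
  fun s x => updateAt c i (u s) x (s x)

theorem improve_of_eq {s : ℕ → ℕ} {n m : ℕ} (h : u s = c (some (i, n, m))) :
    improve c i u s = Function.update s n m := by
  funext x
  by_cases hx : x = n
  · subst hx
    simp [improve, updateAt, h]
  · simp [improve, updateAt, h, hx, Ne.symm hx]

theorem improve_of_ne {s : ℕ → ℕ} (h : ∀ n m, u s ≠ c (some (i, n, m))) :
    improve c i u s = s := by
  funext x
  unfold improve updateAt
  rcases hp : c.symm (u s) with _ | ⟨j, n, m⟩
  · rfl
  · have : j ≠ i := by
      rintro rfl
      exact h n m (by rw [← hp, Equiv.apply_symm_apply])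
    simp [this]

/-- Functions that are values of closed terms. -/
def Definable (s : ℕ → ℕ) : Prop := ∃ t : Tm [] nn, t.val = s

/-- The stability condition of unary update procedures. -/
def Stable (c : Option (ℕ × ℕ × ℕ) ≃ ℕ) (i : ℕ) (u : (ℕ → ℕ) → ℕ) : Prop :=
  ∀ g h, Definable g → Definable h → ∀ n n' l, u g = c (some (i, n, h n)) →
    u h = c (some (i, n', l)) → n' ≠ n

/-- The value of `s` at `n` has been proposed by `u`. -/
def Proposed (c : Option (ℕ × ℕ × ℕ) ≃ ℕ) (i : ℕ) (u : (ℕ → ℕ) → ℕ) (s : ℕ → ℕ) (n : ℕ) : Prop :=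
  ∃ g, Definable g ∧ u g = c (some (i, n, s n))

/-- `s'` is a state that may be reached from `s`. -/
structure Reach (c : Option (ℕ × ℕ × ℕ) ≃ ℕ) (i : ℕ) (u : (ℕ → ℕ) → ℕ) (s s' : ℕ → ℕ) :
    Prop where
  definable : Definable s'
  proposed : ∀ n, s' n ≠ s n → Proposed c i u s' n
  eq : ∀ n, Proposed c i u s n → s' n = s n

theorem Proposed.of_eq {s s' : ℕ → ℕ} {n : ℕ} (h : Proposed c i u s n) (e : s' n = s n) :
    Proposed c i u s' n := by
  rw [Proposed, e]
  exact h

theorem Reach.refl {s : ℕ → ℕ} (hs : Definable s) : Reach c i u s s :=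
  ⟨hs, fun _ h => absurd rfl h, fun _ _ => rfl⟩

theorem Reach.trans {s s' s'' : ℕ → ℕ} (h : Reach c i u s s') (h' : Reach c i u s' s'') :
    Reach c i u s s'' := by
  refine ⟨h'.definable, fun n hn => ?_, fun n hn => ?_⟩
  · by_cases e : s'' n = s' n
    · exact (h.proposed n (e ▸ hn)).of_eq e
    · exact h'.proposed n e
  · have e := h.eq n hn
    exact (h'.eq n (hn.of_eq e)).trans e

/-- The type of four-place functions on the natural numbers. -/
abbrev nat₄ : Ty := Ty.arrow Ty.nat (Ty.arrow Ty.nat (Ty.arrow Ty.nat nn))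

theorem primrec_ite_eq : Primrec fun p : ℕ × ℕ × ℕ × ℕ =>
    (fun a b x y : ℕ => if a = b then x else y) p.1 p.2.1 p.2.2.1 p.2.2.2 :=
  Primrec.ite (Primrec.eq.comp Primrec.fst (Primrec.fst.comp Primrec.snd))
    (Primrec.fst.comp (Primrec.snd.comp Primrec.snd))
    (Primrec.snd.comp (Primrec.snd.comp Primrec.snd))

/-- Stability is assumed for closed terms only, so every state met during learning has to be
definable. -/
theorem Definable.update {s : ℕ → ℕ} (hs : Definable s) (n m : ℕ) :
    Definable (Function.update s n m) := by
  obtain ⟨t, rfl⟩ := hs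
  obtain ⟨e, he⟩ := exists_tm_of_primrec₄ (f := fun a b x y => if a = b then x else y) primrec_ite_eq
  refine ⟨Tm.lam (e _ ⬝ v0 ⬝ num n ⬝ num m ⬝ (t.rename (fun _ y => Var.succ y) ⬝ v0)), ?_⟩
  funext x
  have h₁ : (t.rename (fun _ y => Var.succ y)).sem (Γ := [Ty.nat]) (x, ()) = t.val :=
    t.sem_rename _ () _ fun _ _ => rfl
  change (e [Ty.nat]).sem (x, ()) x ((num n : Tm [Ty.nat] Ty.nat).sem (x, ()))
    ((num m : Tm [Ty.nat] Ty.nat).sem (x, ()))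
    ((t.rename (fun _ y => Var.succ y)).sem (Γ := [Ty.nat]) (x, ()) x) = _
  rw [he, sem_num, sem_num, h₁, Function.update_apply]

/-- The new value is proposed at `s` itself. If some `g` has already proposed the value of `s` at a
place, stability for `g` and `s` forbids an update there. -/
theorem reach_improve (hu : Stable c i u) {s : ℕ → ℕ} (hs : Definable s) :
    Reach c i u s (improve c i u s) := by
  by_cases h : ∀ n m, u s ≠ c (some (i, n, m))
  · rw [improve_of_ne h]
    exact Reach.refl hs
  · push Not at h
    obtain ⟨n, m, h⟩ := h
    rw [improve_of_eq h]
    refine ⟨hs.update n m, fun n' hn' => ?_, fun n' hn' => ?_⟩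
    · obtain rfl : n' = n := by
        by_contra hne
        exact hn' (Function.update_of_ne hne _ _)
      exact ⟨s, hs, by rw [Function.update_self]; exact h⟩
    · obtain ⟨g, hg, hgs⟩ := hn'
      exact Function.update_of_ne (hu g s hg hs _ _ _ hgs h).symm _ _

/-- The tree may be arbitrary: at every leaf the continuation evaluates `u` at the current state and
does not rely on the answer found there. -/
theorem reach_run (hu : Stable c i u) (D : Dialogue ℕ) :
    ∀ s, Definable s → Reach c i u s (D.run (fun _ => improve c i u) s) := by
  induction D with
  | leaf a => intro s hs; exact reach_improve hu hs
  | ask n φ ih =>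
    intro s hs
    have h := ih (s n) s hs
    simp only [Dialogue.run, query]
    split_ifs
    · exact h
    · exact h.trans (ih _ _ h.definable)

/-- Running the tree of `u` either ends in a state without proposed update, or changes the state
at one of the earlier queries `Q`. -/
theorem run_spec (hu : Stable c i u) (D : Dialogue ℕ) :
    ∀ (s : ℕ → ℕ) (Q : Set ℕ), Definable s →
      (∀ α, (∀ q ∈ Q, α q = s q) → u α = D.eval α) →
      (∃ q ∈ Q, D.run (fun _ => improve c i u) s q ≠ s q) ∨
        ∀ n m, u (D.run (fun _ => improve c i u) s) ≠ c (some (i, n, m)) := by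
  induction D with
  | leaf a =>
    intro s Q hs hD
    by_cases h : ∀ n m, u s ≠ c (some (i, n, m))
    · right
      simp only [Dialogue.run]
      rwa [improve_of_ne h]
    · push Not at h
      obtain ⟨n, m, h⟩ := h
      simp only [Dialogue.run]
      rw [improve_of_eq h]
      left
      -- If the update kept all values on `Q`, then `u` would answer as before and propose again at
      -- `n`, where its proposal is already in force; stability forbids this.
      by_contra! hQ
      have h' : u (Function.update s n m) = c (some (i, n, m)) := by
        rw [← h, hD _ hQ, hD s fun _ _ => rfl]
        rfl
      refine hu s (Function.update s n m) hs (hs.update n m) n n m ?_ h' rfl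
      rw [Function.update_self]
      exact h
  | ask n φ ih =>
    intro s Q hs hD
    have hr := reach_run hu (φ (s n)) s hs
    -- The subtree describes `u` only for functions that also agree with `s` at `n`, so `n` joins
    -- the queries.
    have h₁ := ih (s n) s (insert n Q) hs fun α hα => by
      rw [hD α fun q hq => hα q (Set.mem_insert_of_mem n hq), Dialogue.eval,
        hα n (Set.mem_insert n Q)]
    simp only [Dialogue.run, query]
    generalize (φ (s n)).run (fun _ => improve c i u) s = s' at hr h₁ ⊢
    by_cases hn : s' n = s n
    · rw [if_pos hn]
      refine h₁.imp_left ?_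
      rintro ⟨q, rfl | hq, hne⟩
      · exact absurd hn hne
      · exact ⟨q, hq, hne⟩
    · rw [if_neg hn]
      have hr' := reach_run hu (φ (s' n)) s' hr.definable
      by_cases hQ : ∃ q ∈ Q, s' q ≠ s q
      · obtain ⟨q, hq, hne⟩ := hQ
        -- A value changed by the first run is a proposed one, so the second run keeps it.
        refine Or.inl ⟨q, hq, ?_⟩
        rwa [hr'.eq q (hr.proposed q hne)]
      · push Not at hQ
        refine (ih (s' n) s' (insert n Q) hr.definable fun α hα => ?_).imp_left ?_
        · rw [hD α fun q hq => (hα q (Set.mem_insert_of_mem n hq)).trans (hQ q hq),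
            Dialogue.eval, hα n (Set.mem_insert n Q)]
        · rintro ⟨q, rfl | hq, hne⟩
          -- The new value at `n` is proposed and cannot change again: one repetition is enough.
          · exact absurd (hr'.eq q (hr.proposed q hn)) hne
          · exact ⟨q, hq, by rwa [← hQ q hq]⟩

/-- A state without proposed update, for a functional related to a computation. -/
theorem generic_spec (hu : Stable c i u) {w : (Ty.arrow nn Ty.nat).tr.sem}
    (hw : Rel (Ty.arrow nn Ty.nat) (fun _ => u) w) (n m : ℕ) :
    u (w generic (fun _ => improve c i u) fun _ => 0) ≠ c (some (i, n, m)) := by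
  obtain ⟨D, hD, hd⟩ := hw _ _ rel_generic
  rw [hd]
  -- Without earlier queries the first alternative is impossible.
  have h := run_spec hu D (fun _ => 0) ∅ ⟨Tm.lam Tm.zero, rfl⟩ fun α _ => hD α
  simp only [Set.mem_empty_iff_false, false_and, exists_false, false_or] at h
  exact h n m

end Learning

/-! ### The zero of a unary update procedure -/

abbrev v4 {Γ : List Ty} {A B C D E : Ty} : Tm (E :: D :: C :: B :: A :: Γ) A :=
  Tm.var (Var.succ (Var.succ (Var.succ (Var.succ Var.zero))))
abbrev v5 {Γ : List Ty} {A B C D E F : Ty} : Tm (F :: E :: D :: C :: B :: A :: Γ) A :=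
  Tm.var (Var.succ (Var.succ (Var.succ (Var.succ (Var.succ Var.zero)))))

/-- The generic function as a term, from a term `e` for the case distinction by equality. -/
def genericTm (e : ∀ Γ, Tm Γ nat₄) {Γ : List Ty} : Tm Γ nn.tr :=
  Tm.lam (Tm.lam (v1 ⬝ Tm.lam (Tm.lam (Tm.lam
    (e _ ⬝ (v3 ⬝ (v1 ⬝ v2) ⬝ v1 ⬝ v2) ⬝ (v1 ⬝ v2) ⬝ (v3 ⬝ (v1 ⬝ v2) ⬝ v1 ⬝ v0) ⬝
      (v3 ⬝ (v3 ⬝ (v1 ⬝ v2) ⬝ v1 ⬝ v2) ⬝ (v3 ⬝ (v1 ⬝ v2) ⬝ v1) ⬝ v0))))))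

/-- The state reached by a unary functional for the component `i`, from terms for the case
distinction by equality and for updates. -/
def learnTm (e q : ∀ Γ, Tm Γ nat₄) {Γ : List Ty} :
    Tm Γ (Ty.arrow Ty.nat (Ty.arrow (fns 1 Ty.nat) (Ty.arrow (fns 1 Ty.nat).tr nn))) :=
  Tm.lam (Tm.lam (Tm.lam (v0 ⬝ genericTm e ⬝
    -- The continuation ignores its input `v2` and applies the untranslated functional `v4` to the
    -- current state `v1`; hence both versions of the functional are arguments.
    Tm.lam (Tm.lam (Tm.lam (q _ ⬝ v5 ⬝ (v4 ⬝ v1) ⬝ v0 ⬝ (v1 ⬝ v0)))) ⬝ Tm.lam Tm.zero)))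

/-- Lifting of `g` to functionals with `k` parameters and their translations. -/
def lift₂ : (k : ℕ) → {Γ : List Ty} →
    Tm Γ (Ty.arrow (Ty.arrow (fns 1 Ty.nat) (Ty.arrow (fns 1 Ty.nat).tr nn))
      (Ty.arrow (fns k (fns 1 Ty.nat)) (Ty.arrow (fns k (fns 1 Ty.nat)).tr (fns k nn))))
  | 0, _ => Tm.lam v0
  | k + 1, _ => Tm.lam (Tm.lam (A := Ty.arrow nn (fns k (fns 1 Ty.nat)))
      (Tm.lam (A := Ty.arrow nn.tr (fns k (fns 1 Ty.nat)).tr) (Tm.lam (B := fns k nn)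
        (lift₂ k ⬝ v3 ⬝ (v2 ⬝ v0) ⬝ (v1 ⬝ (liftFn ⬝ v0))))))

/-- The zero of the unary update procedure `U` with `k` parameters, for the component `i`. -/
def zeroTm (e q : ∀ Γ, Tm Γ nat₄) (k i : ℕ) (U : Tm [] (fns k (fns 1 Ty.nat))) :
    Tm [] (fns k nn) :=
  lift₂ k ⬝ (learnTm e q ⬝ num i) ⬝ U ⬝ U.tr

theorem sem_learnTm {c : Option (ℕ × ℕ × ℕ) ≃ ℕ} {e q : ∀ Γ, Tm Γ nat₄}
    (he : ∀ Γ ρ, (e Γ).sem ρ = fun a b x y : ℕ => if a = b then x else y)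
    (hq : ∀ Γ ρ, (q Γ).sem ρ = updateAt c) (i : ℕ) (u : (ℕ → ℕ) → ℕ)
    (w : (fns 1 Ty.nat).tr.sem) :
    (learnTm e q (Γ := [])).val i u w = w generic (fun _ => improve c i u) fun _ => 0 := by
  have hg : ∀ Γ (ρ : Env Γ), (genericTm e).sem ρ = generic := by
    intro Γ ρ
    funext d k
    refine congrArg d ?_
    funext n s x
    -- The term decides pointwise at `x`, whereas `query` chooses between functions.
    refine Eq.trans (b := if k (s n) s n = s n then k (s n) s x
      else k (k (s n) s n) (k (s n) s) x) ?_ ?_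
    · exact congrFun (congrFun (congrFun (congrFun (he _ _) _) _) _) _
    · unfold query
      split_ifs <;> rfl
  have h₁ := hg [(fns 1 Ty.nat).tr, fns 1 Ty.nat, Ty.nat] (w, u, i, ())
  refine congrFun (congr (congrArg w h₁) ?_) _
  funext y s x
  exact congrFun (congrFun (congrFun (congrFun (hq _ _) _) _) _) _

/-- The value of a functional at functions. -/
def appsVal {B : Ty} : {k : ℕ} → (fns k B).sem → (Fin k → ℕ → ℕ) → B.sem
  | 0, x, _ => x
  | _ + 1, x, f => appsVal (x (f 0)) fun i => f i.succ

/-- The value of a translated functional at translations of functions. -/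
def appsTr {B : Ty} : {k : ℕ} → (fns k B).tr.sem → (Fin k → ℕ → ℕ) → B.tr.sem
  | 0, x, _ => x
  | _ + 1, x, f => appsTr (x ((liftFn (Γ := [])).val (f 0))) fun i => f i.succ

theorem val_apps {B : Ty} : ∀ {k : ℕ} (t : Tm [] (fns k B)) (f : Fin k → Tm [] nn),
    (t.apps f).val = appsVal t.val fun i => (f i).val
  | 0, _, _ => rfl
  | _ + 1, t, f => val_apps (t ⬝ f 0) fun i => f i.succ

theorem rel_appsTr {B : Ty} : ∀ {k : ℕ} {x : (fns k B).sem} {d : (fns k B).tr.sem}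
    (f : Fin k → ℕ → ℕ), Rel (fns k B) (fun _ => x) d → Rel B (fun _ => appsVal x f) (appsTr d f)
  | 0, _, _, _, h => h
  | _ + 1, _, _, f, h => rel_appsTr (fun i => f i.succ) (h _ _ (rel_liftFn (f 0)))

theorem appsVal_lift₂ : ∀ {k : ℕ} {Γ : List Ty} (ρ : Env Γ)
    (g : (fns 1 Ty.nat).sem → (fns 1 Ty.nat).tr.sem → ℕ → ℕ)
    (x : (fns k (fns 1 Ty.nat)).sem) (d : (fns k (fns 1 Ty.nat)).tr.sem) (f : Fin k → ℕ → ℕ),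
    appsVal ((lift₂ k).sem ρ g x d) f = g (appsVal x f) (appsTr d f)
  | 0, _, _, _, _, _, _ => rfl
  | k + 1, Γ, ρ, g, x, d, f => appsVal_lift₂ (k := k)
      (Γ := nn :: (fns (k + 1) (fns 1 Ty.nat)).tr :: fns (k + 1) (fns 1 Ty.nat) ::
        Ty.arrow (fns 1 Ty.nat) (Ty.arrow (fns 1 Ty.nat).tr nn) :: Γ)
      (f 0, d, x, g, ρ) g (x (f 0)) (d ((liftFn (Γ := [])).val (f 0))) fun i => f i.succ

theorem zeroTm_spec {c : Option (ℕ × ℕ × ℕ) ≃ ℕ} {e q : ∀ Γ, Tm Γ nat₄}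
    (he : ∀ Γ ρ, (e Γ).sem ρ = fun a b x y : ℕ => if a = b then x else y)
    (hq : ∀ Γ ρ, (q Γ).sem ρ = updateAt c) {k i : ℕ} {U : Tm [] (fns k (fns 1 Ty.nat))}
    {f : Fin k → Tm [] nn}
    (hU : ∀ (g h : Tm [] nn) (n m n' l : ℕ),
      Conv (Tm.app (U.apps f) g) (num (c (some (i, n, m)))) → Conv (h ⬝ num n) (num m) →
      Conv (Tm.app (U.apps f) h) (num (c (some (i, n', l)))) → n' ≠ n) (n m : ℕ) :
    ¬ Conv (Tm.app (U.apps f) ((zeroTm e q k i U).apps f)) (num (c (some (i, n, m)))) := by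
  intro hc
  have hs : Stable c i (U.apps f).val := by
    rintro _ _ ⟨g, rfl⟩ ⟨h, rfl⟩ n n' l hg hh
    refine hU g h n (h.val n) n' l ((conv_num_iff _ _).2 hg) ((conv_num_iff _ _).2 ?_)
      ((conv_num_iff _ _).2 hh)
    exact congrArg h.val (sem_num (Γ := []) n ())
  have hv : ((zeroTm e q k i U).apps f).val =
      appsTr U.tr.val (fun j => (f j).val) generic (fun _ => improve c i (U.apps f).val)
        fun _ => 0 := by
    rw [val_apps, val_apps]
    refine (appsVal_lift₂ (Γ := []) () _ U.val U.tr.val _).trans ?_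
    refine Eq.trans ?_ (sem_learnTm he hq i _ _)
    exact congrArg (fun j => (learnTm e q (Γ := [])).val j _ _) (sem_num (Γ := []) i ())
  have hr := rel_appsTr (fun j => (f j).val) (rel_val U)
  rw [← val_apps] at hr
  have := generic_spec hs hr n m
  rw [← hv] at this
  exact this ((conv_num_iff _ _).1 hc)

/-! ### Elimination of the last argument -/

/-- `fns` adds arguments in front, while the last one is to be eliminated. The two types are not
definitionally equal for variable `k`, hence the casts. -/
theorem fns_succ_eq : ∀ (k : ℕ) (B : Ty), fns (k + 1) B = fns k (fns 1 B)
  | 0, _ => rfl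
  | k + 1, B => congrArg (Ty.arrow nn) (fns_succ_eq k B)

/-- A term of a provably equal type. -/
def Tm.cast {A B : Ty} (h : A = B) (t : Tm [] A) : Tm [] B := h ▸ t

theorem Tm.code_cast {A B : Ty} (h : A = B) (t : Tm [] A) : (t.cast h).code = t.code := by
  subst h
  rfl

theorem Tm.cast_app {A B C : Ty} (h : B = C) (t : Tm [] (Ty.arrow A B)) (u : Tm [] A) :
    (t.cast (congrArg (Ty.arrow A) h)).app u = (t.app u).cast h := by
  subst h
  rfl

/-- `U` as a unary functional with parameters. -/
def splitLast {k : ℕ} (U : Tm [] (fns (k + 1) Ty.nat)) : Tm [] (fns k (fns 1 Ty.nat)) :=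
  U.cast (fns_succ_eq k Ty.nat)

theorem splitLast_apps : ∀ {k : ℕ} (U : Tm [] (fns (k + 1) Ty.nat)) (f : Fin k → Tm [] nn)
    (g : Tm [] nn), Tm.app ((splitLast U).apps f) g =
      U.apps (Fin.snoc (α := fun _ => Tm [] nn) f g)
  | 0, _, _, _ => rfl
  | k + 1, U, f, g => by
    have h₀ : Fin.snoc (α := fun _ => Tm [] nn) f g 0 = f 0 := rfl
    have h₁ : (fun j : Fin (k + 1) => Fin.snoc (α := fun _ => Tm [] nn) f g j.succ) =
        Fin.snoc (α := fun _ => Tm [] nn) (fun j => f j.succ) g := by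
      funext j
      refine Fin.lastCases ?_ (fun j => ?_) j
      · rw [Fin.succ_last, Fin.snoc_last, Fin.snoc_last]
      · rw [Fin.succ_castSucc, Fin.snoc_castSucc, Fin.snoc_castSucc]
    have ih := splitLast_apps (Tm.app U (f 0)) (fun j => f j.succ) g
    rw [← h₁] at ih
    refine Eq.trans ?_ ih
    exact congrArg (fun t : Tm [] (fns k (fns 1 Ty.nat)) => Tm.app (t.apps fun j => f j.succ) g)
      (Tm.cast_app (fns_succ_eq k Ty.nat) U (f 0))

/-- Application of functionals with `k` parameters. -/
def appTm : (k : ℕ) → {Γ : List Ty} →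
    Tm Γ (Ty.arrow (fns k (fns 1 Ty.nat)) (Ty.arrow (fns k nn) (fns k Ty.nat)))
  | 0, _ => Tm.lam (A := fns 1 Ty.nat) (Tm.lam (A := nn) (B := Ty.nat)
      (Tm.app (A := nn) (B := Ty.nat) v1 v0))
  | k + 1, _ => Tm.lam (A := Ty.arrow nn (fns k (fns 1 Ty.nat)))
      (Tm.lam (A := Ty.arrow nn (fns k nn)) (Tm.lam (B := fns k Ty.nat)
        (appTm k ⬝ (v2 ⬝ v0) ⬝ (v1 ⬝ v0))))

theorem appsVal_appTm : ∀ {k : ℕ} {Γ : List Ty} (ρ : Env Γ)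
    (x : (fns k (fns 1 Ty.nat)).sem) (y : (fns k nn).sem) (f : Fin k → ℕ → ℕ),
    appsVal (B := Ty.nat) ((appTm k).sem ρ x y) f =
      (appsVal x f : (ℕ → ℕ) → ℕ) (appsVal (B := nn) y f)
  | 0, _, _, _, _, _ => rfl
  | k + 1, Γ, ρ, x, y, f => appsVal_appTm (k := k)
      (Γ := nn :: fns (k + 1) nn :: fns (k + 1) (fns 1 Ty.nat) :: Γ)
      (f 0, y, x, ρ) (x (f 0)) (y (f 0)) fun i => f i.succ

/-! ### Zeros of update procedures with several arguments -/

section Zeros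

variable (e q : ∀ Γ, Tm Γ nat₄)

/-- The last component of a zero, as a function of the others. -/
def lastZero (k : ℕ) (U : Tm [] (fns (k + 1) Ty.nat)) : Tm [] (fns k nn) :=
  zeroTm e q k (k + 1) (splitLast U)

/-- The update procedure in which the last argument has been eliminated. -/
def elimLast (k : ℕ) (U : Tm [] (fns (k + 1) Ty.nat)) : Tm [] (fns k Ty.nat) :=
  appTm k ⬝ splitLast U ⬝ lastZero e q k U

/-- A zero of a `k`-ary update procedure. -/
def zeros : (k : ℕ) → Tm [] (fns k Ty.nat) → Fin k → Tm [] nn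
  | 0, _ => Fin.elim0
  | k + 1, U => Fin.snoc (α := fun _ => Tm [] nn) (zeros k (elimLast e q k U))
      ((lastZero e q k U).apps (zeros k (elimLast e q k U)))

theorem conv_elimLast_apps {k : ℕ} (U : Tm [] (fns (k + 1) Ty.nat)) (f : Fin k → Tm [] nn)
    (n : ℕ) : Conv ((elimLast e q k U).apps f) (num n) ↔
      Conv (U.apps (Fin.snoc (α := fun _ => Tm [] nn) f ((lastZero e q k U).apps f))) (num n) := by
  rw [← splitLast_apps]
  have h₁ := val_apps (splitLast U) f
  have h₂ := val_apps (lastZero e q k U) f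
  have h₃ : ((elimLast e q k U).apps f).val =
      ((splitLast U).apps f).val ((lastZero e q k U).apps f).val := by
    rw [val_apps, h₁, h₂]
    exact appsVal_appTm (Γ := []) () _ _ _
  refine (conv_num_iff _ _).trans (Iff.trans ?_ (conv_num_iff _ _).symm)
  rw [h₃]
  rfl

variable {e q} {c : Option (ℕ × ℕ × ℕ) ≃ ℕ}

theorem conv_snoc_of_lt {k : ℕ} {i : ℕ} {f g : Fin k → Tm [] nn} {t u : Tm [] nn} (hi : i ≤ k)
    (h : ∀ j : Fin k, (j : ℕ) < i → Conv (f j) (g j)) (j : Fin (k + 1)) (hj : (j : ℕ) < i) :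
    Conv (Fin.snoc (α := fun _ => Tm [] nn) f t j)
      (Fin.snoc (α := fun _ => Tm [] nn) g u j) := by
  induction j using Fin.lastCases with
  | last => exact absurd hj (by simpa using hi)
  | cast j =>
    rw [Fin.snoc_castSucc, Fin.snoc_castSucc]
    exact h j hj

/-- With the first `k` arguments fixed, stability in component `k + 1` is the unary stability that
`zeroTm_spec` requires. -/
theorem lastZero_spec
    (he : ∀ Γ ρ, (e Γ).sem ρ = fun a b x y : ℕ => if a = b then x else y)
    (hq : ∀ Γ ρ, (q Γ).sem ρ = updateAt c)
    {k : ℕ} {U : Tm [] (fns (k + 1) Ty.nat)}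
    (hU : IsUpdateProcedure c (k + 1) U) (f : Fin k → Tm [] nn) (n m : ℕ) :
    ¬ Conv (U.apps (Fin.snoc (α := fun _ => Tm [] nn) f ((lastZero e q k U).apps f)))
      (num (c (some (k + 1, n, m)))) := by
  rw [← splitLast_apps]
  refine zeroTm_spec he hq (fun g h n m n' l h₁ h₂ h₃ => ?_) n m
  rw [splitLast_apps] at h₁ h₃
  refine hU.stable _ _ (Fin.last k) n m n' l
    (conv_snoc_of_lt (Fin.val_last k).le fun j _ => Conv.refl _) h₁ ?_ h₃
  rw [Fin.snoc_last]
  exact h₂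

/-- By `lastZero_spec` the index `k + 1` no longer occurs. Stability in a component `i ≤ k` compares
only the arguments before `i`, so it is harmless that `f` and `g` lead to different last arguments.
-/
theorem IsUpdateProcedure.elimLast
    (he : ∀ Γ ρ, (e Γ).sem ρ = fun a b x y : ℕ => if a = b then x else y)
    (hq : ∀ Γ ρ, (q Γ).sem ρ = updateAt c)
    {k : ℕ} {U : Tm [] (fns (k + 1) Ty.nat)}
    (hU : IsUpdateProcedure c (k + 1) U) : IsUpdateProcedure c k (elimLast e q k U) where
  index_mem f i n m h := by
    rw [conv_elimLast_apps] at h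
    obtain ⟨h₁, h₂⟩ := hU.index_mem _ _ _ _ h
    refine ⟨h₁, Nat.lt_succ_iff.1 (lt_of_le_of_ne h₂ ?_)⟩
    rintro rfl
    exact lastZero_spec he hq hU f n m h
  stable f g i n m h l hfg hf hg hgh := by
    rw [conv_elimLast_apps] at hf hgh
    refine hU.stable _ _ i.castSucc n m h l (conv_snoc_of_lt i.is_lt.le hfg) hf ?_ hgh
    rw [Fin.snoc_castSucc]
    exact hg

theorem isZero_zeros
    (he : ∀ Γ ρ, (e Γ).sem ρ = fun a b x y : ℕ => if a = b then x else y)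
    (hq : ∀ Γ ρ, (q Γ).sem ρ = updateAt c) :
    ∀ {k : ℕ} {U : Tm [] (fns k Ty.nat)}, IsUpdateProcedure c k U →
    IsZero c k U (zeros e q k U)
  | 0, U, hU => by
    rcases h : c.symm (U.apps (zeros e q 0 U)).val with _ | ⟨i, n, m⟩
    · refine (conv_num_iff _ _).2 ?_
      rw [← h, Equiv.apply_symm_apply]
    -- Without arguments, an index would satisfy `1 ≤ i ≤ 0`.
    · have := hU.index_mem (zeros e q 0 U) i n m ((conv_num_iff _ _).2
        (by rw [← h, Equiv.apply_symm_apply]))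
      omega
  | _ + 1, U, hU => (conv_elimLast_apps e q U _ _).1
    (isZero_zeros he hq (IsUpdateProcedure.elimLast he hq hU))

end Zeros

/-! ### Recursion on Gödel numbers -/

theorem primrec₂_of_rec {α σ : Type} [Primcodable α] [Primcodable σ] {f : α → ℕ → σ} {z : α → σ}
    {g : α → ℕ → σ → σ} (hz : Primrec z) (hg : Primrec fun p : α × ℕ × σ => g p.1 p.2.1 p.2.2)
    (h₀ : ∀ a, f a 0 = z a) (h₁ : ∀ a n, f a (n + 1) = g a n (f a n)) : Primrec₂ f :=
  (Primrec.nat_rec (g := fun a p => g a p.1 p.2) hz hg).of_eq fun a n => by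
    induction n with
    | zero => exact (h₀ a).symm
    | succ n ih => exact (congrArg (g a n) ih).trans (h₁ a n).symm

theorem primrec_of_rec {σ : Type} [Primcodable σ] {f : ℕ → σ} {g : ℕ → σ → σ}
    (hg : Primrec₂ g) (h : ∀ n, f (n + 1) = g n (f n)) : Primrec f :=
  (primrec₂_of_rec (f := fun _ : Unit => f) (g := fun _ => g) (Primrec.const (f 0))
    (hg.comp (Primrec.fst.comp Primrec.snd) (Primrec.snd.comp Primrec.snd))
    (fun _ => rfl) fun _ => h).comp (Primrec.const ()) Primrec.id

/-- Recursion on Gödel numbers: `g` is given the number, and the values at the possible codes of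
immediate parts. -/
def codeRec (g : ℕ → ℕ → ℕ → ℕ → ℕ) : ℕ → ℕ
  | 0 => 0
  | n + 1 => g n (codeRec g n.unpair.2) (codeRec g n.unpair.2.unpair.1)
      (codeRec g n.unpair.2.unpair.2)
termination_by n => n
decreasing_by
  · exact Nat.lt_succ_of_le (Nat.unpair_right_le _)
  · exact Nat.lt_succ_of_le ((Nat.unpair_left_le _).trans (Nat.unpair_right_le _))
  · exact Nat.lt_succ_of_le ((Nat.unpair_right_le _).trans (Nat.unpair_right_le _))

theorem codeRec_pair (g : ℕ → ℕ → ℕ → ℕ → ℕ) (t b : ℕ) :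
    codeRec g (Nat.pair t b + 1) =
      g (Nat.pair t b) (codeRec g b) (codeRec g b.unpair.1) (codeRec g b.unpair.2) := by
  rw [codeRec, Nat.unpair_pair]

/-- Course-of-values recursion: the three recursive calls concern smaller numbers, whose values are
looked up in the list of earlier values. The length of this list is the argument. -/
theorem primrec_codeRec {g : ℕ → ℕ → ℕ → ℕ → ℕ}
    (hg : Primrec fun p : ℕ × ℕ × ℕ × ℕ => g p.1 p.2.1 p.2.2.1 p.2.2.2) :
    Primrec (codeRec g) := by
  let get : List ℕ × ℕ → ℕ → ℕ := fun p i => p.1.getD i 0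
  have hget {j : List ℕ × ℕ → ℕ} (hj : Primrec j) : Primrec fun p => get p (j p) :=
    (Primrec.list_getD 0).comp Primrec.fst hj
  have h₂ : Primrec fun p : List ℕ × ℕ => p.2.unpair.2 :=
    Primrec.snd.comp (Primrec.unpair.comp Primrec.snd)
  have h : Primrec₂ fun (_ : Unit) (n : ℕ) => codeRec g n := by
    refine Primrec.nat_strong_rec (fun (_ : Unit) n => codeRec g n)
      (g := fun _ l => some (l.length.casesOn 0 fun n => g n (get (l, n) n.unpair.2)
        (get (l, n) n.unpair.2.unpair.1) (get (l, n) n.unpair.2.unpair.2))) ?_ ?_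
    · refine Primrec.option_some.comp (Primrec.nat_casesOn
        (Primrec.list_length.comp Primrec.snd) (Primrec.const 0) ?_)
      refine (hg.comp (Primrec.pair Primrec.snd (Primrec.pair (hget h₂) (Primrec.pair
        (hget (Primrec.fst.comp (Primrec.unpair.comp h₂)))
        (hget (Primrec.snd.comp (Primrec.unpair.comp h₂))))))).comp
        (Primrec.pair (Primrec.snd.comp Primrec.fst) Primrec.snd)
    · intro _ n
      have hl {i : ℕ} (hi : i < n) : get ((List.range n).map (codeRec g), n) i = codeRec g i := by
        simp [get, hi]
      cases n with
      | zero => simp [codeRec]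
      | succ n =>
        have e₁ := Nat.lt_succ_of_le (Nat.unpair_right_le n)
        have e₂ := (Nat.unpair_left_le n.unpair.2).trans_lt e₁
        have e₃ := (Nat.unpair_right_le n.unpair.2).trans_lt e₁
        have := hl e₁
        have := hl e₂
        have := hl e₃
        simp_all [codeRec, get]
  exact h.comp (Primrec.const ()) Primrec.id

/-! ### Codes of terms -/

def cArrow (a b : ℕ) : ℕ := Nat.pair 3 (Nat.pair a b) + 1
def cUn (t a : ℕ) : ℕ := Nat.pair t a + 1
def cPair (a b : ℕ) : ℕ := Nat.pair 10 (Nat.pair a b) + 1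
def cApp (a b : ℕ) : ℕ := Nat.pair 7 (Nat.pair a b) + 1
def cLam (a b : ℕ) : ℕ := Nat.pair 11 (Nat.pair a b) + 1

section

variable {α : Type} [Primcodable α] {f g : α → ℕ}

theorem primrec_cUn (hf : Primrec f) (hg : Primrec g) : Primrec fun x => cUn (f x) (g x) :=
  Primrec.succ.comp (Primrec₂.natPair.comp hf hg)

theorem primrec_cArrow (hf : Primrec f) (hg : Primrec g) : Primrec fun x => cArrow (f x) (g x) :=
  primrec_cUn (Primrec.const 3) (Primrec₂.natPair.comp hf hg)

theorem primrec_cPair (hf : Primrec f) (hg : Primrec g) : Primrec fun x => cPair (f x) (g x) :=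
  primrec_cUn (Primrec.const 10) (Primrec₂.natPair.comp hf hg)

theorem primrec_cApp (hf : Primrec f) (hg : Primrec g) : Primrec fun x => cApp (f x) (g x) :=
  primrec_cUn (Primrec.const 7) (Primrec₂.natPair.comp hf hg)

theorem primrec_cLam (hf : Primrec f) (hg : Primrec g) : Primrec fun x => cLam (f x) (g x) :=
  primrec_cUn (Primrec.const 11) (Primrec₂.natPair.comp hf hg)

end

/-- The code of the variable with index `i`. -/
def cVar (i : ℕ) : ℕ := cUn 0 i

/-! ### Codes of the translation -/

def cCont (a : ℕ) : ℕ := cArrow (cArrow a ans.code) ans.code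

/-- The code of the translation of a type. -/
def trTyCode : ℕ → ℕ := codeRec fun n _ r₁ r₂ =>
  -- The tags 0 and 1 are the base types, and `n + 1` is the whole code.
  if n.unpair.1 < 2 then cCont (n + 1) else cUn n.unpair.1 (Nat.pair r₁ r₂)

theorem primrec_cCont {α : Type} [Primcodable α] {f : α → ℕ} (hf : Primrec f) :
    Primrec fun x => cCont (f x) :=
  primrec_cArrow (primrec_cArrow hf (Primrec.const _)) (Primrec.const _)

theorem primrec_trTyCode : Primrec trTyCode := by
  have h : Primrec fun p : ℕ × ℕ × ℕ × ℕ => p.1.unpair.1 :=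
    Primrec.fst.comp (Primrec.unpair.comp Primrec.fst)
  exact primrec_codeRec (Primrec.ite (Primrec.nat_lt.comp h (Primrec.const 2))
    (primrec_cCont (Primrec.succ.comp Primrec.fst))
    (primrec_cUn h (Primrec₂.natPair.comp (Primrec.fst.comp (Primrec.snd.comp Primrec.snd))
      (Primrec.snd.comp (Primrec.snd.comp Primrec.snd)))))

theorem trTyCode_code (A : Ty) : trTyCode A.code = A.tr.code := by
  induction A with
  | nat | bool =>
    rw [trTyCode, Ty.code, codeRec_pair, Nat.unpair_pair, if_pos (by norm_num)]
    rfl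
  | prod A B ihA ihB | arrow A B ihA ihB =>
    rw [trTyCode, Ty.code, codeRec_pair, Nat.unpair_pair, if_neg (by norm_num), ← trTyCode,
      Nat.unpair_pair, ihA, ihB]
    rfl

/-- The code of `ext b A`, from those of `b` and `A`. -/
def extCode (b : ℕ) : ℕ → ℕ := codeRec fun n _ r₁ r₂ =>
  cLam (cArrow b (trTyCode (n + 1))) <| cLam (cCont b) <|
    if n.unpair.1 < 2 then
      cLam (cArrow (n + 1) ans.code)
        (cApp (cVar 1) (cLam b (cApp (cApp (cVar 3) (cVar 0)) (cVar 1))))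
    else if n.unpair.1 = 2 then
      cPair (cApp (cApp r₁ (cLam b (cUn 8 (cApp (cVar 2) (cVar 0))))) (cVar 0))
        (cApp (cApp r₂ (cLam b (cUn 9 (cApp (cVar 2) (cVar 0))))) (cVar 0))
    else
      cLam (trTyCode n.unpair.2.unpair.1)
        (cApp (cApp r₂ (cLam b (cApp (cApp (cVar 3) (cVar 0)) (cVar 1)))) (cVar 1))

theorem primrec_extCode (b : ℕ) : Primrec (extCode b) := by
  have hn : Primrec fun p : ℕ × ℕ × ℕ × ℕ => p.1 + 1 := Primrec.succ.comp Primrec.fst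
  have h₁ : Primrec fun p : ℕ × ℕ × ℕ × ℕ => p.1.unpair.1 :=
    Primrec.fst.comp (Primrec.unpair.comp Primrec.fst)
  have h₂ : Primrec fun p : ℕ × ℕ × ℕ × ℕ => p.1.unpair.2.unpair.1 :=
    Primrec.fst.comp (Primrec.unpair.comp (Primrec.snd.comp (Primrec.unpair.comp Primrec.fst)))
  have hr₁ : Primrec fun p : ℕ × ℕ × ℕ × ℕ => p.2.2.1 :=
    Primrec.fst.comp (Primrec.snd.comp Primrec.snd)
  have hr₂ : Primrec fun p : ℕ × ℕ × ℕ × ℕ => p.2.2.2 :=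
    Primrec.snd.comp (Primrec.snd.comp Primrec.snd)
  refine primrec_codeRec (primrec_cLam (primrec_cArrow (Primrec.const b)
    (primrec_trTyCode.comp hn)) (primrec_cLam (Primrec.const _)
    (Primrec.ite (Primrec.nat_lt.comp h₁ (Primrec.const 2)) ?_
      (Primrec.ite (Primrec.eq.comp h₁ (Primrec.const 2)) ?_ ?_))))
  · exact primrec_cLam (primrec_cArrow hn (Primrec.const _)) (Primrec.const _)
  · exact primrec_cPair (primrec_cApp (primrec_cApp hr₁ (Primrec.const _)) (Primrec.const _))
      (primrec_cApp (primrec_cApp hr₂ (Primrec.const _)) (Primrec.const _))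
  · exact primrec_cLam (primrec_trTyCode.comp h₂)
      (primrec_cApp (primrec_cApp hr₂ (Primrec.const _)) (Primrec.const _))

/-- Codes record de Bruijn indices and the types of bound variables, but no context; one number
therefore serves for all `Γ`. -/
theorem extCode_code (b A : Ty) {Γ : List Ty} :
    extCode b.code A.code = (ext b A (Γ := Γ)).code := by
  induction A generalizing Γ with
  | nat | bool =>
    rw [extCode, Ty.code, codeRec_pair, Nat.unpair_pair, if_pos (by norm_num), ← Ty.code,
      trTyCode_code]
    rfl
  | prod A B ihA ihB =>
    rw [extCode, Ty.code, codeRec_pair, Nat.unpair_pair, if_neg (by norm_num),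
      if_pos (by norm_num), ← extCode, ← Ty.code, trTyCode_code, Nat.unpair_pair, ihA, ihB]
    rfl
  | arrow A B ihA ihB =>
    have h : trTyCode (Nat.pair 3 (Nat.pair A.code B.code) + 1) = (Ty.arrow A B).tr.code :=
      trTyCode_code (Ty.arrow A B)
    change extCode b.code (Nat.pair 3 (Nat.pair A.code B.code) + 1) = _
    rw [extCode, codeRec_pair, Nat.unpair_pair, if_neg (by norm_num),
      if_neg (by norm_num), ← extCode, h, Nat.unpair_pair, ihB, trTyCode_code]
    rfl

def trCondCode (a : ℕ) : ℕ :=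
  cLam (cont Ty.bool).code <| cLam (trTyCode a) <| cLam (trTyCode a) <|
    cApp (cApp (extCode Ty.bool.code a) (cLam Ty.bool.code
      (cApp (cApp (cApp (cUn 4 (trTyCode a)) (cVar 0)) (cVar 2)) (cVar 1)))) (cVar 2)

def trRecnCode (a : ℕ) : ℕ :=
  cLam (trTyCode a) <|
    cLam (cArrow (cont Ty.nat).code (cArrow (trTyCode a) (trTyCode a))) <| cLam (cont Ty.nat).code <|
      cApp (cApp (extCode Ty.nat.code a) (cApp (cApp (cUn 5 (trTyCode a)) (cVar 2))
        (cLam Ty.nat.code (cApp (cVar 2)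
          (cLam (Ty.arrow Ty.nat ans).code (cApp (cVar 0) (cVar 1))))))) (cVar 0)

theorem primrec_trCondCode : Primrec trCondCode := by
  have h := primrec_trTyCode
  exact primrec_cLam (Primrec.const _) (primrec_cLam h (primrec_cLam h (primrec_cApp (primrec_cApp
    (primrec_extCode _) (primrec_cLam (Primrec.const _) (primrec_cApp (primrec_cApp (primrec_cApp
      (primrec_cUn (Primrec.const _) h) (Primrec.const _)) (Primrec.const _)) (Primrec.const _))))
    (Primrec.const _))))

theorem primrec_trRecnCode : Primrec trRecnCode := by
  have h := primrec_trTyCode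
  exact primrec_cLam h (primrec_cLam (primrec_cArrow (Primrec.const _) (primrec_cArrow h h))
    (primrec_cLam (Primrec.const _) (primrec_cApp (primrec_cApp (primrec_extCode _)
      (primrec_cApp (primrec_cApp (primrec_cUn (Primrec.const _) h) (Primrec.const _))
        (Primrec.const _))) (Primrec.const _))))

theorem trCondCode_code (A : Ty) {Γ : List Ty} :
    trCondCode A.code = (trCond A (Γ := Γ)).code := by
  rw [trCondCode, trTyCode_code,
    extCode_code Ty.bool A (Γ := A.tr :: A.tr :: cont Ty.bool :: Γ)]
  rfl

theorem trRecnCode_code (A : Ty) {Γ : List Ty} :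
    trRecnCode A.code = (trRecn A (Γ := Γ)).code := by
  rw [trRecnCode, trTyCode_code, extCode_code Ty.nat A (Γ := cont Ty.nat ::
    Ty.arrow (cont Ty.nat) (Ty.arrow A.tr A.tr) :: A.tr :: Γ)]
  rfl

/-- The code of the translation of a term. -/
def trCode : ℕ → ℕ := codeRec fun n r r₁ r₂ =>
  if n.unpair.1 = 0 then n + 1
  else if n.unpair.1 = 1 then (Tm.tr (Tm.zero (Γ := []))).code
  else if n.unpair.1 = 2 then (Tm.tr (Tm.tt (Γ := []))).code
  else if n.unpair.1 = 3 then (Tm.tr (Tm.ff (Γ := []))).code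
  else if n.unpair.1 = 4 then trCondCode n.unpair.2
  else if n.unpair.1 = 5 then trRecnCode n.unpair.2
  else if n.unpair.1 = 6 then cApp (trSuc (Γ := [])).code r
  else if n.unpair.1 = 8 ∨ n.unpair.1 = 9 then cUn n.unpair.1 r
  else if n.unpair.1 = 11 then cLam (trTyCode n.unpair.2.unpair.1) r₂
  -- Among codes of terms, the tags left are 7 and 10: application and pairing.
  else cUn n.unpair.1 (Nat.pair r₁ r₂)

theorem primrec_trCode : Primrec trCode := by
  have h₁ : Primrec fun p : ℕ × ℕ × ℕ × ℕ => p.1.unpair.1 :=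
    Primrec.fst.comp (Primrec.unpair.comp Primrec.fst)
  have h₂ : Primrec fun p : ℕ × ℕ × ℕ × ℕ => p.1.unpair.2 :=
    Primrec.snd.comp (Primrec.unpair.comp Primrec.fst)
  have hr : Primrec fun p : ℕ × ℕ × ℕ × ℕ => p.2.1 := Primrec.fst.comp Primrec.snd
  have hr₁ : Primrec fun p : ℕ × ℕ × ℕ × ℕ => p.2.2.1 :=
    Primrec.fst.comp (Primrec.snd.comp Primrec.snd)
  have hr₂ : Primrec fun p : ℕ × ℕ × ℕ × ℕ => p.2.2.2 :=
    Primrec.snd.comp (Primrec.snd.comp Primrec.snd)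
  have heq (m : ℕ) : PrimrecPred fun p : ℕ × ℕ × ℕ × ℕ => p.1.unpair.1 = m :=
    Primrec.eq.comp h₁ (Primrec.const m)
  exact primrec_codeRec (Primrec.ite (heq 0) (Primrec.succ.comp Primrec.fst)
    (Primrec.ite (heq 1) (Primrec.const _) (Primrec.ite (heq 2) (Primrec.const _)
    (Primrec.ite (heq 3) (Primrec.const _) (Primrec.ite (heq 4) (primrec_trCondCode.comp h₂)
    (Primrec.ite (heq 5) (primrec_trRecnCode.comp h₂)
    (Primrec.ite (heq 6) (primrec_cApp (Primrec.const _) hr)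
    (Primrec.ite ((heq 8).or (heq 9)) (primrec_cUn h₁ hr)
    (Primrec.ite (heq 11)
      (primrec_cLam (primrec_trTyCode.comp (Primrec.fst.comp (Primrec.unpair.comp h₂))) hr₂)
    (primrec_cUn h₁ (Primrec₂.natPair.comp hr₁ hr₂)))))))))))

theorem Var.index_tr {Γ : List Ty} {A : Ty} (x : Var Γ A) : x.tr.index = x.index := by
  induction x with
  | zero => rfl
  | succ x ih => exact congrArg (· + 1) ih

theorem trCode_code {Γ : List Ty} {A : Ty} (t : Tm Γ A) : trCode t.code = t.tr.code := by
  induction t with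
  | var x =>
    simp only [trCode, Tm.code, codeRec_pair, Nat.unpair_pair, Tm.tr, Var.index_tr, if_true]
  | zero | tt | ff =>
    simp only [trCode, Tm.code, codeRec_pair, Nat.unpair_pair]
    rfl
  | cond A =>
    rw [trCode, Tm.code, codeRec_pair, Nat.unpair_pair]
    exact trCondCode_code A
  | recn A =>
    rw [trCode, Tm.code, codeRec_pair, Nat.unpair_pair]
    exact trRecnCode_code A
  | suc t ih | fst t ih | snd t ih =>
    rw [trCode, Tm.code, codeRec_pair, ← trCode, ih, Nat.unpair_pair]
    rfl
  | app t u iht ihu | pair t u iht ihu =>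
    rw [trCode, Tm.code, codeRec_pair, ← trCode, Nat.unpair_pair, Nat.unpair_pair, iht, ihu]
    rfl
  | @lam Γ A B t ih =>
    rw [trCode, Tm.code, codeRec_pair, ← trCode, Nat.unpair_pair, Nat.unpair_pair, ih]
    simp only [trTyCode_code]
    rfl

/-! ### Codes of the zeros -/

def fnsCode (b : ℕ) : ℕ → ℕ
  | 0 => b
  | k + 1 => cArrow nn.code (fnsCode b k)

theorem primrec_fnsCode (b : ℕ) : Primrec (fnsCode b) :=
  primrec_of_rec (g := fun _ => cArrow nn.code)
    (primrec_cArrow (Primrec.const _) Primrec.snd) fun _ => rfl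

theorem fnsCode_code (B : Ty) (k : ℕ) : fnsCode B.code k = (fns k B).code := by
  induction k with
  | zero => rfl
  | succ k ih => exact congrArg (cArrow nn.code) ih

def lift₂Step (k a : ℕ) : ℕ :=
  cLam (Ty.arrow (fns 1 Ty.nat) (Ty.arrow (fns 1 Ty.nat).tr nn)).code <|
    cLam (fnsCode (fns 1 Ty.nat).code (k + 1)) <|
    cLam (trTyCode (fnsCode (fns 1 Ty.nat).code (k + 1))) <| cLam nn.code <|
    cApp (cApp (cApp a (cVar 3)) (cApp (cVar 2) (cVar 0)))
      (cApp (cVar 1) (cApp (liftFn (Γ := [])).code (cVar 0)))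

def lift₂Code : ℕ → ℕ
  | 0 => (lift₂ 0 (Γ := [])).code
  | k + 1 => lift₂Step k (lift₂Code k)

theorem primrec_lift₂Code : Primrec lift₂Code := by
  have h : Primrec fun p : ℕ × ℕ => fnsCode (fns 1 Ty.nat).code (p.1 + 1) :=
    (primrec_fnsCode _).comp (Primrec.succ.comp Primrec.fst)
  have hs : Primrec₂ lift₂Step :=
    primrec_cLam (Primrec.const _) (primrec_cLam h (primrec_cLam
      (primrec_trTyCode.comp h) (primrec_cLam (Primrec.const _) (primrec_cApp (primrec_cApp
        (primrec_cApp Primrec.snd (Primrec.const _)) (Primrec.const _)) (Primrec.const _)))))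
  exact primrec_of_rec hs fun _ => rfl

theorem lift₂Code_eq (k : ℕ) {Γ : List Ty} : lift₂Code k = (lift₂ k (Γ := Γ)).code := by
  induction k generalizing Γ with
  | zero => rfl
  | succ k ih =>
    rw [lift₂Code, lift₂Step, fnsCode_code, trTyCode_code]
    refine congrArg (cLam _) (congrArg (cLam _) (congrArg (cLam _) (congrArg (cLam _) ?_)))
    exact congrArg (fun a => cApp (cApp (cApp a _) _) _) ih

def appTmStep (k a : ℕ) : ℕ :=
  cLam (fnsCode (fns 1 Ty.nat).code (k + 1)) <| cLam (fnsCode nn.code (k + 1)) <|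
    cLam nn.code <| cApp (cApp a (cApp (cVar 2) (cVar 0))) (cApp (cVar 1) (cVar 0))

def appTmCode : ℕ → ℕ
  | 0 => (appTm 0 (Γ := [])).code
  | k + 1 => appTmStep k (appTmCode k)

theorem primrec_appTmCode : Primrec appTmCode := by
  have h (b : ℕ) : Primrec fun p : ℕ × ℕ => fnsCode b (p.1 + 1) :=
    (primrec_fnsCode _).comp (Primrec.succ.comp Primrec.fst)
  have hs : Primrec₂ appTmStep :=
    primrec_cLam (h _) (primrec_cLam (h _) (primrec_cLam (Primrec.const _)
      (primrec_cApp (primrec_cApp Primrec.snd (Primrec.const _)) (Primrec.const _))))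
  exact primrec_of_rec hs fun _ => rfl

theorem appTmCode_eq (k : ℕ) {Γ : List Ty} : appTmCode k = (appTm k (Γ := Γ)).code := by
  induction k generalizing Γ with
  | zero => rfl
  | succ k ih =>
    rw [appTmCode, appTmStep, fnsCode_code, fnsCode_code]
    refine congrArg (cLam _) (congrArg (cLam _) (congrArg (cLam _) ?_))
    exact congrArg (fun a => cApp (cApp a _) _) ih

def numCode (n : ℕ) : ℕ := (num n : Tm [] Ty.nat).code

theorem primrec_numCode : Primrec numCode :=
  primrec_of_rec (g := fun _ a => cUn 6 a) (primrec_cUn (Primrec.const 6) Primrec.snd)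
    fun _ => rfl

section Zeros

variable (e q : ∀ Γ, Tm Γ nat₄)

def zeroTmCode (k i u : ℕ) : ℕ :=
  cApp (cApp (cApp (lift₂Code k) (cApp (learnTm e q (Γ := [])).code (numCode i))) u) (trCode u)

theorem primrec_zeroTmCode {α : Type} [Primcodable α] {k i u : α → ℕ} (hk : Primrec k)
    (hi : Primrec i) (hu : Primrec u) : Primrec fun a => zeroTmCode e q (k a) (i a) (u a) :=
  primrec_cApp (primrec_cApp (primrec_cApp (primrec_lift₂Code.comp hk)
    (primrec_cApp (Primrec.const _) (primrec_numCode.comp hi))) hu) (primrec_trCode.comp hu)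

theorem zeroTmCode_code (k i : ℕ) (U : Tm [] (fns k (fns 1 Ty.nat))) :
    zeroTmCode e q k i U.code = (zeroTm e q k i U).code := by
  rw [zeroTmCode, trCode_code, lift₂Code_eq k (Γ := [])]
  rfl

def lastZeroCode (k u : ℕ) : ℕ := zeroTmCode e q k (k + 1) u

theorem primrec_lastZeroCode {α : Type} [Primcodable α] {k u : α → ℕ} (hk : Primrec k)
    (hu : Primrec u) : Primrec fun a => lastZeroCode e q (k a) (u a) :=
  primrec_zeroTmCode e q hk (Primrec.succ.comp hk) hu

theorem lastZeroCode_code {k : ℕ} (U : Tm [] (fns (k + 1) Ty.nat)) :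
    lastZeroCode e q k U.code = (lastZero e q k U).code := by
  rw [lastZero, ← zeroTmCode_code, splitLast, Tm.code_cast]
  rfl

def elimLastCode (k u : ℕ) : ℕ := cApp (cApp (appTmCode k) u) (lastZeroCode e q k u)

theorem elimLastCode_code {k : ℕ} (U : Tm [] (fns (k + 1) Ty.nat)) :
    elimLastCode e q k U.code = (elimLast e q k U).code := by
  rw [elimLastCode, lastZeroCode_code, appTmCode_eq k (Γ := []),
    ← Tm.code_cast (fns_succ_eq k Ty.nat) U]
  rfl

theorem Tm.code_apps {B : Ty} : ∀ {k : ℕ} (t : Tm [] (fns k B)) (f : Fin k → Tm [] nn),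
    (t.apps f).code = (List.ofFn fun i => (f i).code).foldl cApp t.code
  | 0, _, _ => rfl
  | _ + 1, t, f => by
    rw [List.ofFn_succ]
    exact Tm.code_apps (Tm.app t (f 0)) fun i => f i.succ

/-- The code of the update procedure in which the last `j` of `k` arguments are eliminated. -/
def elimCode (k u : ℕ) : ℕ → ℕ
  | 0 => u
  | j + 1 => elimLastCode e q (k - 1 - j) (elimCode k u j)

theorem primrec_elimCode : Primrec₂ fun p : ℕ × ℕ => elimCode e q p.1 p.2 := by
  have hk : Primrec fun p : (ℕ × ℕ) × ℕ × ℕ => p.1.1 - 1 - p.2.1 :=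
    Primrec.nat_sub.comp (Primrec.nat_sub.comp (Primrec.fst.comp Primrec.fst) (Primrec.const 1))
      (Primrec.fst.comp Primrec.snd)
  have hu : Primrec fun p : (ℕ × ℕ) × ℕ × ℕ => p.2.2 := Primrec.snd.comp Primrec.snd
  exact primrec₂_of_rec (g := fun p j r => elimLastCode e q (p.1 - 1 - j) r) Primrec.snd
    (primrec_cApp (primrec_cApp (primrec_appTmCode.comp hk) hu) (primrec_lastZeroCode e q hk hu))
    (fun _ => rfl) fun _ _ => rfl

/-- `zeros` changes the procedure in its recursive call, whereas primitive recursion keeps its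
parameters. `elimCode` iterates the eliminations instead; moving the first one inside reconciles the
two orders. -/
theorem elimCode_succ (k u j : ℕ) :
    elimCode e q (k + 1) u (j + 1) = elimCode e q k (elimLastCode e q k u) j := by
  induction j with
  | zero => rfl
  | succ j ih =>
    rw [elimCode, ih, elimCode]
    congr 1
    omega

/-- The codes of the first `i` components of a zero. -/
def zerosCode (k u : ℕ) : ℕ → List ℕ
  | 0 => []
  -- After `k - 1 - i` eliminations, `i + 1` arguments remain; the last is obtained from the first
  -- `i` components.
  | i + 1 => zerosCode k u i ++
      [(zerosCode k u i).foldl cApp (lastZeroCode e q i (elimCode e q k u (k - 1 - i)))]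

theorem primrec_zerosCode : Primrec₂ fun p : ℕ × ℕ => zerosCode e q p.1 p.2 := by
  have hi : Primrec fun p : (ℕ × ℕ) × ℕ × List ℕ => p.2.1 := Primrec.fst.comp Primrec.snd
  have hl : Primrec fun p : (ℕ × ℕ) × ℕ × List ℕ => p.2.2 := Primrec.snd.comp Primrec.snd
  have hk : Primrec fun p : (ℕ × ℕ) × ℕ × List ℕ => p.1.1 - 1 - p.2.1 :=
    Primrec.nat_sub.comp (Primrec.nat_sub.comp (Primrec.fst.comp Primrec.fst) (Primrec.const 1)) hi
  have ha : Primrec₂ fun (_ : (ℕ × ℕ) × ℕ × List ℕ) (p : ℕ × ℕ) => cApp p.1 p.2 :=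
    primrec_cApp (Primrec.fst.comp Primrec.snd) (Primrec.snd.comp Primrec.snd)
  exact primrec₂_of_rec (z := fun _ => []) (g := fun p i l => l ++
      [l.foldl cApp (lastZeroCode e q i (elimCode e q p.1 p.2 (p.1 - 1 - i)))])
    (Primrec.const _)
    (Primrec.list_concat.comp hl (Primrec.list_foldl hl (primrec_lastZeroCode e q hi
      ((primrec_elimCode e q).comp Primrec.fst hk)) ha))
    (fun _ => rfl) fun _ _ => rfl

theorem zerosCode_succ {k i : ℕ} (u : ℕ) (hi : i ≤ k) :
    zerosCode e q (k + 1) u i = zerosCode e q k (elimLastCode e q k u) i := by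
  induction i with
  | zero => rfl
  | succ i ih =>
    have h : k + 1 - 1 - i = k - 1 - i + 1 := by omega
    rw [zerosCode, zerosCode, ih (by omega), h, elimCode_succ]

theorem zerosCode_code : ∀ {k : ℕ} (U : Tm [] (fns k Ty.nat)),
    zerosCode e q k U.code k = List.ofFn fun i => (zeros e q k U i).code
  | 0, _ => rfl
  | k + 1, U => by
    have h : k + 1 - 1 - k = 0 := by omega
    rw [zerosCode, zerosCode_succ e q _ le_rfl, h, elimCode, elimLastCode_code,
      zerosCode_code (elimLast e q k U), List.ofFn_succ', List.concat_eq_append,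
      lastZeroCode_code, ← Tm.code_apps]
    simp only [zeros, Fin.snoc_castSucc, Fin.snoc_last]

end Zeros

end SystemT

/-! ### The zero theorem -/

theorem mainTheorem7 (c : Option (ℕ × ℕ × ℕ) ≃ ℕ) (hc : Primrec c) (hc' : Primrec c.symm) :
    (∃ F : ℕ × ℕ → ℕ, Computable F ∧
      ∀ (k : ℕ) (U : SystemT.Tm [] (SystemT.fns k (SystemT.fns 1 SystemT.Ty.nat))),
        (∀ f : Fin k → SystemT.Tm [] SystemT.nn, SystemT.IsUpdateProcedure c 1 (U.apps f)) →
        ∃ ε : SystemT.Tm [] (SystemT.fns k SystemT.nn),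
          F (k, U.code) = ε.code ∧
          ∀ f : Fin k → SystemT.Tm [] SystemT.nn,
            SystemT.IsZero c 1 (U.apps f) (fun _ => ε.apps f)) ∧
    (∃ F : ℕ × ℕ × ℕ → ℕ, Computable F ∧
      ∀ (k : ℕ) (U : SystemT.Tm [] (SystemT.fns k SystemT.Ty.nat)),
        SystemT.IsUpdateProcedure c k U →
        ∃ ε : Fin k → SystemT.Tm [] SystemT.nn,
          (∀ i : Fin k, F (k, U.code, (i : ℕ)) = (ε i).code) ∧
          SystemT.IsZero c k U ε) := by
  obtain ⟨e, he⟩ :=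
    SystemT.exists_tm_of_primrec₄ (f := fun a b x y => if a = b then x else y) SystemT.primrec_ite_eq
  obtain ⟨q, hq⟩ :=
    SystemT.exists_tm_of_primrec₄ (f := SystemT.updateAt c) (SystemT.primrec_updateAt hc')
  refine ⟨⟨fun p => SystemT.zeroTmCode e q p.1 1 p.2, ?_, fun k U hU => ?_⟩,
    -- The default 0 is irrelevant, as only positions below `k` matter.
    fun p => (SystemT.zerosCode e q p.1 p.2.1 p.1).getD p.2.2 0, ?_, fun k U hU => ?_⟩
  · exact (SystemT.primrec_zeroTmCode e q Primrec.fst (Primrec.const 1) Primrec.snd).to_comp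
  · refine ⟨SystemT.zeroTm e q k 1 U, SystemT.zeroTmCode_code e q k 1 U, fun f => ?_⟩
    have hval := (SystemT.conv_num_iff ((U.apps f).apps fun _ : Fin 1 =>
      (SystemT.zeroTm e q k 1 U).apps f) _).2 rfl
    rcases h : c.symm ((U.apps f).apps fun _ : Fin 1 =>
      (SystemT.zeroTm e q k 1 U).apps f).val with _ | ⟨i, n, m⟩
    all_goals
      rw [Equiv.symm_apply_eq] at h
      rw [h] at hval
    · exact hval
    -- The index condition leaves only component 1, for which the term was built.
    · obtain rfl : i = 1 := by
        have := (hU f).index_mem _ _ _ _ hval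
        omega
      refine absurd hval (SystemT.zeroTm_spec he hq (fun g h n m n' l h₁ h₂ h₃ => ?_) n m)
      exact (hU f).stable (fun _ => g) (fun _ => h) 0 n m n' l
        (fun j hj => absurd hj (Fin.not_lt_zero j)) h₁ h₂ h₃
  · exact ((Primrec.list_getD 0).comp ((SystemT.primrec_zerosCode e q).comp
      (Primrec.pair Primrec.fst (Primrec.fst.comp Primrec.snd)) Primrec.fst)
      (Primrec.snd.comp Primrec.snd)).to_comp
  · refine ⟨SystemT.zeros e q k U, fun i => ?_, SystemT.isZero_zeros he hq hU⟩
    simp [SystemT.zerosCode_code]
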